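/- Let $n\in\{1,2,3\}$, $m\in\mathbb{Z}_{>0}$ and $q\in(-1,1)$. Let $e_1,\dots,e_n$ be the standard basis of $\mathbb{R}^n$, let $\omega_j=e_1+\cdots+e_j-\frac{j}{n}(e_1+\cdots+e_n)$ for $1\le j\le n-1$, and put $$\Lambda^{(m,n)}=\{l_1\omega_1+\cdots+l_{n-1}\omega_{n-1}\mid l_1,\dots,l_{n-1}\in\mathbb{Z}_{\ge 0},\ l_1+\cdots+l_{n-1}\le m\}.$$ For $\boldsymbol\xi\in\mathbb{R}^n$ with $\xi_j-\xi_k\notin 2\pi\mathbb{Z}$ ($j\neq k$) and $\mu\in\Lambda^{(m,n)}$ let $$C(\boldsymbol\xi;q)=\prod_{1\le j<k\le n}\frac{1-q\,e^{-i(\xi_j-\xi_k)}}{1-e^{-i(\xi_j-\xi_k)}},\qquad P_\mu(\boldsymbol\xi;q)=\sum_{\sigma\in S_n}C(\xi_{\sigma_1},\dots,\xi_{\sigma_n};q)\,e^{i\xi_{\sigma_1}\mu_1+\cdots+i\xi_{\sigma_n}\mu_n},$$ $$\delta_\mu(q)=\prod_{\substack{1\le j<k\le n\\ \mu_j-\mu_k=0}}\frac{1-q^{k-j}}{1-q^{1+k-j}}\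 \prod_{\substack{1\le j<k\le n\\ \mu_j-\mu_k=m}}\frac{1-q^{n-k+j}}{1-q^{n+1-k+j}}.$$ Let $u_q(\theta)=\frac{1-q^2}{1-2q\cos\theta+q^2}$ and $v_q(\vartheta)=\int_0^\vartheta u_q(\theta)\,d\theta$. For $\lambda\in\Lambda^{(m,n)}$ let $\boldsymbol\xi_\lambda$ denote the unique global minimum of the Morse function $$V_\lambda(\boldsymbol\xi)=\sum_{1\le j<k\le n}\int_0^{\xi_j-\xi_k}v_q(\vartheta)\,d\vartheta+\sum_{1\le j\le n}\Bigl(\tfrac m2\xi_j^2-2\pi\bigl(\tfrac{n+1-2j}{2}+\lambda_j\bigr)\xi_j\Bigr),\qquad\boldsymbol\xi\in\mathbb{R}^n$$ (its coordinates satisfy $0<\xi_j-\xi_k<2\pi$ for $j<k$), and let $H_{j,k}(\boldsymbol\xi)=\partial_{\xi_j}\partial_{\xi_k}V_\lambda(\boldsymbol\xi)$. Define the CUE Christoffel weight $$\Delta_\lambda=|C(\boldsymbol\xi_\lambda;q)|^2\Bigl(\sum_{\mu\in\Lambda^{(m,n)}}|P_\mu(\boldsymbol\xi_\lambda;q)|^2\,\delta_\mu(q)\Bigr)^{-1}.$$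 Then for every $\lambda\in\Lambda^{(m,n)}$ $$\Delta_\lambda=\frac mn\Bigl(\det\bigl[H_{j,k}(\boldsymbol\xi_\lambda)\bigr]_{1\le j,k\le n}\Bigr)^{-1}.$$ -/

import Mathlib

open Finset

namespace HLCubature

/-! Vectors in `ℝⁿ` are functions `Fin n → ℝ`; the usual index `j ∈ {1, …, n}` corresponds to
`j : Fin n` with value `j - 1`.  A product over pairs `1 ≤ j < k ≤ n` is written
`∏ j, ∏ k ∈ Ioi j`. -/

/-- The fundamental weight `ω_{j+1} = e_1 + ⋯ + e_{j+1} - ((j+1)/n) (e_1 + ⋯ + e_n)`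
of `SU(n)`, for `j = 0, …, n - 2`. -/
noncomputable def fundamentalWeight (n : ℕ) (j : Fin (n - 1)) : Fin n → ℝ :=
  fun i => (if (i : ℕ) ≤ (j : ℕ) then 1 else 0) - ((j : ℕ) + 1 : ℝ) / n

/-- The set of dominant weights `l_1 ω_1 + ⋯ + l_{n-1} ω_{n-1}` with `l_j ∈ ℤ_{≥ 0}` and
`l_1 + ⋯ + l_{n-1} ≤ m`. -/
def alcove (m n : ℕ) : Set (Fin n → ℝ) :=
  {μ | ∃ l : Fin (n - 1) → ℕ, ∑ j, l j ≤ m ∧ μ = ∑ j, (l j : ℝ) • fundamentalWeight n j}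

theorem alcove_finite (m n : ℕ) : (alcove m n).Finite := by
  have h : {l : Fin (n - 1) → ℕ | ∑ j, l j ≤ m}.Finite := by
    refine (Set.finite_Iic (fun _ : Fin (n - 1) => m)).subset ?_
    intro l hl j
    exact (Finset.single_le_sum (f := l) (fun i _ => Nat.zero_le _) (mem_univ j)).trans hl
  refine (h.image (fun l => ∑ j, (l j : ℝ) • fundamentalWeight n j)).subset ?_
  rintro μ ⟨l, hl, rfl⟩
  exact ⟨l, hl, rfl⟩

/-- `C(ξ; q) = ∏_{j<k} (1 - q e^{-i(ξ_j - ξ_k)}) / (1 - e^{-i(ξ_j - ξ_k)})`. -/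
noncomputable def cFun {n : ℕ} (q : ℝ) (ξ : Fin n → ℝ) : ℂ :=
  ∏ j, ∏ k ∈ Ioi j,
    (1 - (q : ℂ) * Complex.exp (-(Complex.I * ((ξ j - ξ k : ℝ) : ℂ)))) /
      (1 - Complex.exp (-(Complex.I * ((ξ j - ξ k : ℝ) : ℂ))))

/-- The Hall-Littlewood polynomial
`P_μ(ξ; q) = ∑_σ C(ξ_{σ_1}, …, ξ_{σ_n}; q) exp(i ξ_{σ_1} μ_1 + ⋯ + i ξ_{σ_n} μ_n)`. -/
noncomputable def hallLittlewood {n : ℕ} (q : ℝ) (μ ξ : Fin n → ℝ) : ℂ :=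
  ∑ σ : Equiv.Perm (Fin n),
    cFun q (fun j => ξ (σ j)) * Complex.exp (Complex.I * ((∑ j, ξ (σ j) * μ j : ℝ) : ℂ))

/-- The discrete orthogonality weights `δ_μ^{(m,n)}(q)`. -/
noncomputable def deltaWeight (m : ℕ) {n : ℕ} (q : ℝ) (μ : Fin n → ℝ) : ℝ :=
  (∏ j, ∏ k ∈ Ioi j, if μ j - μ k = 0 then
      (1 - q ^ ((k : ℕ) - (j : ℕ))) / (1 - q ^ (1 + (k : ℕ) - (j : ℕ))) else 1) *
  (∏ j, ∏ k ∈ Ioi j, if μ j - μ k = (m : ℝ) then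
      (1 - q ^ (n - (k : ℕ) + (j : ℕ))) / (1 - q ^ (n + 1 - (k : ℕ) + (j : ℕ))) else 1)

/-- `u_q(θ) = (1 - q²) / (1 - 2 q cos θ + q²)`. -/
noncomputable def u (q θ : ℝ) : ℝ := (1 - q ^ 2) / (1 - 2 * q * Real.cos θ + q ^ 2)

/-- `v_q(ϑ) = ∫₀^ϑ u_q(θ) dθ`. -/
noncomputable def v (q ϑ : ℝ) : ℝ := ∫ θ in (0 : ℝ)..ϑ, u q θ

/-- `ϱ_j = (n + 1 - 2 j) / 2`, `j = 1, …, n`. -/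
noncomputable def rho (n : ℕ) (j : Fin n) : ℝ := ((n : ℝ) + 1 - 2 * ((j : ℕ) + 1 : ℝ)) / 2

/-- The Morse function `V_λ^{(m,n)} : ℝⁿ → ℝ`. -/
noncomputable def morse (m : ℕ) {n : ℕ} (q : ℝ) (lam ξ : Fin n → ℝ) : ℝ :=
  (∑ j, ∑ k ∈ Ioi j, ∫ ϑ in (0 : ℝ)..(ξ j - ξ k), v q ϑ) +
    ∑ j, ((m : ℝ) / 2 * ξ j ^ 2 - 2 * Real.pi * (rho n j + lam j) * ξ j)

/-- The Hessian matrix `H_{j,k}(ξ) = ∂_{ξ_j} ∂_{ξ_k} V_λ(ξ)` of the Morse function. -/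
noncomputable def hessian (m : ℕ) {n : ℕ} (q : ℝ) (lam ξ : Fin n → ℝ) :
    Matrix (Fin n) (Fin n) ℝ :=
  Matrix.of fun j k =>
    lineDeriv ℝ (fun η => lineDeriv ℝ (morse m q lam) η (Pi.single k 1)) ξ (Pi.single j 1)

theorem u_pos {q : ℝ} (h1 : -1 < q) (h2 : q < 1) (θ : ℝ) : 0 < u q θ := by
  have hc1 := Real.neg_one_le_cos θ
  have hc2 := Real.cos_le_one θ
  have hs := Real.sin_sq_add_cos_sq θ
  unfold u
  apply div_pos
  · nlinarith
  · rcases eq_or_ne q 0 with h | h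
    · subst h; norm_num
    · rcases le_total 0 q with h0 | h0 <;> nlinarith

theorem u_continuous {q : ℝ} (h1 : -1 < q) (h2 : q < 1) : Continuous (u q) := by
  unfold u
  refine Continuous.div (by fun_prop) (by fun_prop) fun θ h => ?_
  have := u_pos h1 h2 θ
  unfold u at this
  rw [h, div_zero] at this
  exact lt_irrefl _ this

theorem v_hasDerivAt {q : ℝ} (h1 : -1 < q) (h2 : q < 1) (x : ℝ) :
    HasDerivAt (v q) (u q x) x :=
  intervalIntegral.integral_hasDerivAt_right ((u_continuous h1 h2).intervalIntegrable _ _)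
    ((u_continuous h1 h2).stronglyMeasurableAtFilter _ _) (u_continuous h1 h2).continuousAt

theorem v_continuous {q : ℝ} (h1 : -1 < q) (h2 : q < 1) : Continuous (v q) :=
  continuous_iff_continuousAt.2 fun x => (v_hasDerivAt h1 h2 x).continuousAt

theorem v_mono {q : ℝ} (h1 : -1 < q) (h2 : q < 1) : Monotone (v q) :=
  monotone_of_deriv_nonneg (fun x => (v_hasDerivAt h1 h2 x).differentiableAt)
    fun x => by rw [(v_hasDerivAt h1 h2 x).deriv]; exact (u_pos h1 h2 x).le

theorem w_hasDerivAt {q : ℝ} (h1 : -1 < q) (h2 : q < 1) (x : ℝ) :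
    HasDerivAt (fun y => ∫ ϑ in (0 : ℝ)..y, v q ϑ) (v q x) x :=
  intervalIntegral.integral_hasDerivAt_right ((v_continuous h1 h2).intervalIntegrable _ _)
    ((v_continuous h1 h2).stronglyMeasurableAtFilter _ _) (v_continuous h1 h2).continuousAt

theorem w_continuous {q : ℝ} (h1 : -1 < q) (h2 : q < 1) :
    Continuous (fun y => ∫ ϑ in (0 : ℝ)..y, v q ϑ) :=
  continuous_iff_continuousAt.2 fun x => (w_hasDerivAt h1 h2 x).continuousAt

theorem w_nonneg {q : ℝ} (h1 : -1 < q) (h2 : q < 1) (x : ℝ) :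
    0 ≤ ∫ ϑ in (0 : ℝ)..x, v q ϑ := by
  have h0 : v q 0 = 0 := by simp [v]
  rcases le_total 0 x with h | h
  · exact intervalIntegral.integral_nonneg h fun y hy => h0 ▸ v_mono h1 h2 hy.1
  · rw [intervalIntegral.integral_symm, ← intervalIntegral.integral_neg]
    refine intervalIntegral.integral_nonneg h fun y hy => ?_
    have := v_mono h1 h2 hy.2
    linarith

theorem w_midpoint {q : ℝ} (h1 : -1 < q) (h2 : q < 1) (x y : ℝ) :
    (∫ ϑ in (0 : ℝ)..((x + y) / 2), v q ϑ) ≤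
      ((∫ ϑ in (0 : ℝ)..x, v q ϑ) + ∫ ϑ in (0 : ℝ)..y, v q ϑ) / 2 := by
  have hd : deriv (fun y => ∫ ϑ in (0 : ℝ)..y, v q ϑ) = v q :=
    funext fun x => (w_hasDerivAt h1 h2 x).deriv
  have hc : ConvexOn ℝ Set.univ (fun y => ∫ ϑ in (0 : ℝ)..y, v q ϑ) :=
    Monotone.convexOn_univ_of_deriv
      (fun x => (w_hasDerivAt h1 h2 x).differentiableAt) (by rw [hd]; exact v_mono h1 h2)
  have := hc.2 (Set.mem_univ x) (Set.mem_univ y) (show (0 : ℝ) ≤ 1 / 2 by norm_num)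
    (show (0 : ℝ) ≤ 1 / 2 by norm_num) (by norm_num)
  simp only [smul_eq_mul] at this
  rw [show (x + y) / 2 = 1 / 2 * x + 1 / 2 * y by ring]
  linarith

theorem morse_continuous (m : ℕ) {n : ℕ} {q : ℝ} (h1 : -1 < q) (h2 : q < 1)
    (lam : Fin n → ℝ) : Continuous (morse m q lam) := by
  unfold morse
  have hw := w_continuous h1 h2
  refine Continuous.add ?_ (by fun_prop)
  refine continuous_finsetSum _ fun j _ => continuous_finsetSum _ fun k _ => ?_
  exact hw.comp (by fun_prop : Continuous fun ξ : Fin n → ℝ => ξ j - ξ k)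

/-- For `m ≥ 1` and `-1 < q < 1` the Morse function has a unique global minimum. -/
theorem existsUnique_minimizer {m : ℕ} (hm : 1 ≤ m) {n : ℕ} {q : ℝ} (h1 : -1 < q) (h2 : q < 1)
    (lam : Fin n → ℝ) : ∃! ξ : Fin n → ℝ, ∀ η, morse m q lam ξ ≤ morse m q lam η := by
  have hm' : (1 : ℝ) ≤ m := by exact_mod_cast hm
  have hex : ∃ ξ : Fin n → ℝ, ∀ η, morse m q lam ξ ≤ morse m q lam η := by
    refine (morse_continuous m h1 h2 lam).exists_forall_le' 0 ?_
    set K : ℝ := ∑ j, (2 * Real.pi * (rho n j + lam j)) ^ 2 with hK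
    have hK0 : 0 ≤ K := Finset.sum_nonneg fun j _ => sq_nonneg _
    have h0 : morse m q lam 0 = 0 := by simp [morse]
    filter_upwards [tendsto_norm_cocompact_atTop.eventually_ge_atTop (4 * K + 1)] with x hx
    rw [h0]
    have hn : ∃ j, 4 * K + 1 ≤ |x j| := by
      by_contra! hlt
      have : ‖x‖ < 4 * K + 1 := (pi_norm_lt_iff (by positivity)).2 hlt
      linarith
    obtain ⟨j0, hj0⟩ := hn
    have hW : 0 ≤ ∑ j, ∑ k ∈ Ioi j, ∫ ϑ in (0 : ℝ)..(x j - x k), v q ϑ :=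
      Finset.sum_nonneg fun j _ => Finset.sum_nonneg fun k _ => w_nonneg h1 h2 _
    have hQ : ∑ j, (x j ^ 2 / 4 - (2 * Real.pi * (rho n j + lam j)) ^ 2) ≤
        ∑ j, ((m : ℝ) / 2 * x j ^ 2 - 2 * Real.pi * (rho n j + lam j) * x j) := by
      refine Finset.sum_le_sum fun j _ => ?_
      generalize 2 * Real.pi * (rho n j + lam j) = c
      nlinarith [sq_nonneg (x j - 2 * c), mul_nonneg (sub_nonneg.2 hm') (sq_nonneg (x j))]
    have hS : x j0 ^ 2 / 4 ≤ ∑ j, x j ^ 2 / 4 :=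
      Finset.single_le_sum (f := fun j => x j ^ 2 / 4) (fun j _ => by positivity) (mem_univ j0)
    rw [Finset.sum_sub_distrib, ← hK] at hQ
    have hsq : (4 * K + 1) ^ 2 ≤ x j0 ^ 2 := by
      rw [← sq_abs (x j0)]
      exact pow_le_pow_left₀ (by positivity) hj0 2
    unfold morse
    nlinarith
  obtain ⟨ξ, hξ⟩ := hex
  refine ⟨ξ, hξ, fun η hη => ?_⟩
  have heq : morse m q lam η = morse m q lam ξ := le_antisymm (hη ξ) (hξ η)
  have hmid := hξ (fun j => (ξ j + η j) / 2)
  have hle : morse m q lam (fun j => (ξ j + η j) / 2) ≤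
      (morse m q lam ξ + morse m q lam η) / 2 - ∑ j, (m : ℝ) / 8 * (ξ j - η j) ^ 2 := by
    have hA : (∑ j, ∑ k ∈ Ioi j,
          ∫ ϑ in (0 : ℝ)..((ξ j + η j) / 2 - (ξ k + η k) / 2), v q ϑ) ≤
        ((∑ j, ∑ k ∈ Ioi j, ∫ ϑ in (0 : ℝ)..(ξ j - ξ k), v q ϑ) +
          ∑ j, ∑ k ∈ Ioi j, ∫ ϑ in (0 : ℝ)..(η j - η k), v q ϑ) / 2 := by
      rw [← Finset.sum_add_distrib, Finset.sum_div]
      refine Finset.sum_le_sum fun j _ => ?_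
      rw [← Finset.sum_add_distrib, Finset.sum_div]
      refine Finset.sum_le_sum fun k _ => ?_
      rw [show (ξ j + η j) / 2 - (ξ k + η k) / 2 = ((ξ j - ξ k) + (η j - η k)) / 2 by ring]
      exact w_midpoint h1 h2 _ _
    have hB : ∑ j, ((m : ℝ) / 2 * ((ξ j + η j) / 2) ^ 2
          - 2 * Real.pi * (rho n j + lam j) * ((ξ j + η j) / 2)) =
        ((∑ j, ((m : ℝ) / 2 * ξ j ^ 2 - 2 * Real.pi * (rho n j + lam j) * ξ j)) +
          ∑ j, ((m : ℝ) / 2 * η j ^ 2 - 2 * Real.pi * (rho n j + lam j) * η j)) / 2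
          - ∑ j, (m : ℝ) / 8 * (ξ j - η j) ^ 2 := by
      rw [← Finset.sum_add_distrib, Finset.sum_div, ← Finset.sum_sub_distrib]
      exact Finset.sum_congr rfl fun j _ => by ring
    unfold morse
    linarith
  have hsum : ∑ j, (m : ℝ) / 8 * (ξ j - η j) ^ 2 ≤ 0 := by linarith
  have hnn : ∀ j ∈ (univ : Finset (Fin n)), 0 ≤ (m : ℝ) / 8 * (ξ j - η j) ^ 2 :=
    fun j _ => by positivity
  funext j
  have hz := (Finset.sum_eq_zero_iff_of_nonneg hnn).1
    (le_antisymm hsum (Finset.sum_nonneg hnn)) j (mem_univ j)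
  have hm8 : (m : ℝ) / 8 ≠ 0 := by positivity
  have := pow_eq_zero_iff (two_ne_zero) |>.1 ((mul_eq_zero.1 hz).resolve_left hm8)
  linarith

/-- The node `ξ_λ^{(m,n)}`: the unique global minimum of the Morse function. -/
noncomputable def node {m : ℕ} (hm : 1 ≤ m) {n : ℕ} {q : ℝ} (h1 : -1 < q) (h2 : q < 1)
    (lam : Fin n → ℝ) : Fin n → ℝ :=
  (existsUnique_minimizer hm h1 h2 lam).choose

theorem node_spec {m : ℕ} (hm : 1 ≤ m) {n : ℕ} {q : ℝ} (h1 : -1 < q) (h2 : q < 1)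
    (lam : Fin n → ℝ) (η : Fin n → ℝ) :
    morse m q lam (node hm h1 h2 lam) ≤ morse m q lam η :=
  (existsUnique_minimizer hm h1 h2 lam).choose_spec.1 η

/-- The Hall-Littlewood Christoffel weight
`Δ̂_λ = (∑_{μ ∈ Λ^{(m,n)}} |P_μ(ξ_λ; q)|² δ_μ(q))⁻¹`. -/
noncomputable def christoffelHat {m : ℕ} (hm : 1 ≤ m) {n : ℕ} {q : ℝ} (h1 : -1 < q) (h2 : q < 1)
    (lam : Fin n → ℝ) : ℝ :=
  (∑ μ ∈ (alcove_finite m n).toFinset,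
    ‖hallLittlewood q μ (node hm h1 h2 lam)‖ ^ 2 * deltaWeight m q μ)⁻¹

/-- The Christoffel weight for the circular unitary ensemble: `Δ_λ = |C(ξ_λ; q)|² Δ̂_λ`. -/
noncomputable def christoffelCUE {m : ℕ} (hm : 1 ≤ m) {n : ℕ} {q : ℝ} (h1 : -1 < q) (h2 : q < 1)
    (lam : Fin n → ℝ) : ℝ :=
  ‖cFun q (node hm h1 h2 lam)‖ ^ 2 * christoffelHat hm h1 h2 lam

end HLCubature

/-!
The weight is computed by evaluating the squared norm `∑ μ, |P_μ(ξ)|² δ_μ` in closed form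
at the node.

Put `x_j = exp(i ξ_j)`. Up to a common phase, `P_μ(ξ)` is a sum over permutations of plane waves in
the `x_j` (a Bethe wave function), and the coefficients of two plane waves that differ by exchanging
neighbouring variables `a, b` have ratio `S(a, b) = -(a - q b) / (b - q a)`. The function `v_q` is
`θ + 2 arctan (q sin θ / (1 - q cos θ))`, so `exp(i v_q(α - β))` is `-S` at the exponentials of `α`
and `β` (`phase_v_sub`), and the vanishing of the gradient of the Morse function at its minimum
becomes the Bethe equations `x_j ^ m ∏_{k ≠ j} (-S(x_j, x_k)) = ζ` with a common right-hand side
(`bethe_equation`, `phase_rho_add_eq`). Monotonicity and quasi-periodicity of `v_q` show that the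
`x_j` are distinct (`sub_mem_Ioo_of_morseGradient_eq_zero`), so no denominator vanishes.

For `n = 3` the weight `δ_μ` is `1` in the interior of the triangular alcove and constant on open
sides and corners (`deltaWeight_weightThree`). Hence the sum over the alcove of a product of two
plane waves is a weighted geometric sum, which localizes at the corners (distinct ratios), at a side
and the opposite corner (two equal ratios), or is a polynomial in `m` (equal plane waves). In each
corner contribution the `m`-th powers are eliminated with the Bethe equations, and the contributions
of the six relative permutations become rational functions of the `x_j`, linear in `m` except for
the diagonal one (`BetheTriple.symmSum_wavePairing`). A rational function identity
(`symmSum_contributions`) then gives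
`∑ μ, |P_μ|² δ_μ = 3 |C|² (m² + 2 m (u₁₂ + u₁₃ + u₂₃) + 3 (u₁₂ u₁₃ + u₁₂ u₂₃ + u₁₃ u₂₃))`
with `u_{jk} = u_q(ξ_j - ξ_k)`. The Hessian is `m` times the identity plus the Laplacian of the
complete graph with edge weights `u_{jk}`, and its determinant is `m` times the same quadratic
polynomial (`det_hessian_three`). The case `n = 2` is the same argument on a segment, and for
`n = 1` all sums have a single term.
-/

namespace HLCubature

section Algebra

variable {K : Type*} [Field K]

/-! ### Weighted geometric sums over the alcove -/

/-- The sum of `a ^ i * b ^ j` over the lattice triangle `i + j ≤ m`. -/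
def triangleSum (m : ℕ) (a b : K) : K :=
  ∑ k ∈ range (m + 1), ∑ i ∈ range (k + 1), a ^ i * b ^ (k - i)

/-- The sum of `a ^ i * b ^ j` over the lattice triangle `i + j ≤ m`, where the weight `1` of a
point is lowered by `s` for each side of the triangle it lies on and raised by `t` at a corner. -/
def weightedTriangleSum (s t : K) (m : ℕ) (a b : K) : K :=
  triangleSum m a b -
    s * (∑ k ∈ range (m + 1), b ^ k + ∑ k ∈ range (m + 1), a ^ k +
      ∑ i ∈ range (m + 1), a ^ i * b ^ (m - i)) + t * (1 + a ^ m + b ^ m)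

/-- The contribution of the corner with variable `a` to the weighted triangle sum in the
homogeneous variables `a`, `b`, `c`. -/
def cornerTerm (s t a b c : K) : K :=
  a ^ 2 / ((a - b) * (a - c)) - s * (a / (a - b) + a / (a - c)) + t

/-- The contribution to the weighted triangle sum in the homogeneous variables `a`, `1`, `1` of the
side joining the two corners with equal variables; here `N` stands for `m + 1`. -/
def sideTerm (s t N a : K) : K :=
  -(N / (a - 1)) - a / (a - 1) ^ 2 - s * (N - 2 / (a - 1)) + 2 * t

theorem sum_range_pow_mul_pow {a b : K} (h : a ≠ b) (k : ℕ) :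
    ∑ i ∈ range (k + 1), a ^ i * b ^ (k - i) = (a ^ (k + 1) - b ^ (k + 1)) / (a - b) := by
  rw [eq_div_iff (sub_ne_zero.2 h)]
  exact (Commute.all a b).geom_sum₂_mul (k + 1)

theorem triangleSum_of_ne {a b : K} (hab : a ≠ b) (ha : a ≠ 1) (hb : b ≠ 1) (m : ℕ) :
    triangleSum m a b = a ^ m * (a ^ 2 / ((a - b) * (a - 1))) +
      b ^ m * (b ^ 2 / ((b - a) * (b - 1))) + 1 / ((1 - a) * (1 - b)) := by
  have h1 := sub_ne_zero.2 hab
  have h2 := sub_ne_zero.2 ha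
  have h3 := sub_ne_zero.2 hb
  unfold triangleSum
  simp_rw [sum_range_pow_mul_pow hab]
  rw [← sum_div, sum_sub_distrib]
  simp_rw [pow_succ _ (_ : ℕ), ← sum_mul]
  rw [geom_sum_eq ha, geom_sum_eq hb, show b - a = -(a - b) by ring,
    show 1 - a = -(a - 1) by ring, show 1 - b = -(b - 1) by ring]
  field_simp
  ring

theorem triangleSum_one_one [CharZero K] (m : ℕ) :
    triangleSum m (1 : K) 1 = ((m : K) + 1) * (m + 2) / 2 := by
  unfold triangleSum
  induction m with
  | zero => simp
  | succ m ih =>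
    rw [sum_range_succ, ih]
    simp
    ring

theorem triangleSum_one_right {a : K} (ha : a ≠ 1) (m : ℕ) :
    triangleSum m a 1 = a ^ m * (a ^ 2 / (a - 1) ^ 2) - (m + 1) / (a - 1) - a / (a - 1) ^ 2 := by
  have h := sub_ne_zero.2 ha
  unfold triangleSum
  simp_rw [sum_range_pow_mul_pow ha]
  rw [← sum_div, sum_sub_distrib]
  simp_rw [pow_succ _ (_ : ℕ), ← sum_mul]
  rw [geom_sum_eq ha]
  simp
  field_simp
  ring

theorem triangleSum_comm (m : ℕ) (a b : K) : triangleSum m a b = triangleSum m b a := by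
  unfold triangleSum
  refine sum_congr rfl fun k _ => ?_
  rw [← sum_range_reflect]
  refine sum_congr rfl fun i hi => ?_
  have hi' : i ≤ k := by simpa [Nat.lt_succ_iff] using hi
  rw [show k + 1 - 1 - i = k - i by omega, Nat.sub_sub_self hi', mul_comm]

theorem weightedTriangleSum_comm (s t : K) (m : ℕ) (a b : K) :
    weightedTriangleSum s t m a b = weightedTriangleSum s t m b a := by
  have h : ∑ i ∈ range (m + 1), a ^ i * b ^ (m - i) =
      ∑ i ∈ range (m + 1), b ^ i * a ^ (m - i) := by
    rw [← sum_range_reflect]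
    refine sum_congr rfl fun i hi => ?_
    have hi' : i ≤ m := by simpa [Nat.lt_succ_iff] using hi
    rw [show m + 1 - 1 - i = m - i by omega, Nat.sub_sub_self hi', mul_comm]
  unfold weightedTriangleSum
  rw [triangleSum_comm, h]
  ring

theorem triangleSum_self {a : K} (ha : a ≠ 1) (m : ℕ) :
    triangleSum m a a = 1 / (1 - a) ^ 2 + a ^ m * ((m + 1) * a / (a - 1) - a / (a - 1) ^ 2) := by
  have h := sub_ne_zero.2 ha
  have h' := sub_ne_zero.2 ha.symm
  unfold triangleSum
  induction m with
  | zero =>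
    simp
    rw [show 1 - a = -(a - 1) by ring]
    field_simp
    ring
  | succ m ih =>
    have : ∑ i ∈ range (m + 1 + 1), a ^ i * a ^ (m + 1 - i) = (m + 2) * a ^ (m + 1) := by
      rw [sum_congr rfl fun i hi => by
        rw [← pow_add, Nat.add_sub_cancel' (Nat.lt_succ_iff.1 (mem_range.1 hi))], sum_const,
        card_range, nsmul_eq_mul]
      push_cast
      ring
    rw [sum_range_succ, ih, this]
    push_cast
    rw [show 1 - a = -(a - 1) by ring]
    field_simp
    ring

theorem weightedTriangleSum_of_ne (s t : K) {a b : K} (hab : a ≠ b) (ha : a ≠ 1) (hb : b ≠ 1)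
    (m : ℕ) :
    weightedTriangleSum s t m a b = a ^ m * cornerTerm s t a b 1 +
      b ^ m * cornerTerm s t b a 1 + cornerTerm s t 1 a b := by
  have h1 := sub_ne_zero.2 hab
  have h2 := sub_ne_zero.2 ha
  have h3 := sub_ne_zero.2 hb
  unfold weightedTriangleSum cornerTerm
  rw [triangleSum_of_ne hab ha hb, sum_range_pow_mul_pow hab, geom_sum_eq ha, geom_sum_eq hb,
    show b - a = -(a - b) by ring, show 1 - a = -(a - 1) by ring, show 1 - b = -(b - 1) by ring]
  field_simp
  ring

theorem weightedTriangleSum_one_one [CharZero K] (s t : K) (m : ℕ) :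
    weightedTriangleSum s t m 1 1 = ((m : K) + 1) * (m + 2) / 2 - 3 * s * (m + 1) + 3 * t := by
  unfold weightedTriangleSum
  rw [triangleSum_one_one]
  simp
  ring

theorem weightedTriangleSum_one_right (s t : K) {a : K} (ha : a ≠ 1) (m : ℕ) :
    weightedTriangleSum s t m a 1 = a ^ m * cornerTerm s t a 1 1 + sideTerm s t (m + 1) a := by
  have h := sub_ne_zero.2 ha
  unfold weightedTriangleSum cornerTerm sideTerm
  rw [triangleSum_one_right ha, sum_range_pow_mul_pow ha, geom_sum_eq ha]
  simp
  field_simp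
  ring

theorem weightedTriangleSum_self (s t : K) {a : K} (ha : a ≠ 1) (ha0 : a ≠ 0) (m : ℕ) :
    weightedTriangleSum s t m a a = cornerTerm s t 1 a a + a ^ m * sideTerm s t (m + 1) a⁻¹ := by
  have h := sub_ne_zero.2 ha
  have hs : ∑ i ∈ range (m + 1), a ^ i * a ^ (m - i) = (m + 1) * a ^ m := by
    rw [sum_congr rfl fun i hi => by
      rw [← pow_add, Nat.add_sub_cancel' (Nat.lt_succ_iff.1 (mem_range.1 hi))]]
    simp
  have hinv : a⁻¹ - 1 = -(a - 1) / a := by field_simp; ring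
  unfold weightedTriangleSum cornerTerm sideTerm
  rw [triangleSum_self ha, hs, geom_sum_eq ha, hinv, show 1 - a = -(a - 1) by ring]
  field_simp
  ring

/-! ### The two-particle scattering factor -/

/-- The two-particle scattering factor `-(a - q b) / (b - q a)`, the ratio of the coefficients of
two plane waves that differ by an exchange of neighbouring variables `a` and `b`. -/
def scattering (q a b : K) : K := -((a - q * b) / (b - q * a))

/-- The function `u_q(α - β)` in terms of the variables `a = e^{iα}` and `b = e^{iβ}`. -/
def kernelU (q a b : K) : K := (1 - q ^ 2) * (a * b) / ((a - q * b) * (b - q * a))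

/-- The amount by which the Hall-Littlewood orthogonality weight drops on a side of the alcove. -/
def sideDefect (q : K) : K := q / (1 + q)

/-- The excess of the Hall-Littlewood orthogonality weight at a corner of the triangular alcove over
the value `1 - 2 * sideDefect q`. -/
def cornerExcess (q : K) : K := q ^ 3 / ((1 + q) * (1 + q + q ^ 2))

theorem scattering_mul_swap {q a b : K} (h1 : a - q * b ≠ 0) (h2 : b - q * a ≠ 0) :
    scattering q a b * scattering q b a = 1 := by
  unfold scattering
  rw [neg_mul_neg, div_mul_div_comm, mul_comm (b - q * a), div_self (mul_ne_zero h1 h2)]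

/-- The part of the two-variable side contributions proportional to `m + 1` produces `u_q`. -/
theorem scattering_pair_sum {q a b : K} (hab : a - b ≠ 0)
    (h1 : a - q * b ≠ 0) (h2 : b - q * a ≠ 0) (hq : 1 + q ≠ 0) :
    scattering q a b * (-(b / (a - b)) - sideDefect q) +
      scattering q b a * (-(a / (b - a)) - sideDefect q) =
    2 * kernelU q a b - 1 + 2 * sideDefect q := by
  -- `field_simp` recognizes the denominator `b - q * a` only with its factors in this order.
  have h2' : b - a * q ≠ 0 := by rwa [mul_comm a q]
  unfold scattering kernelU sideDefect
  rw [show b - a = -(a - b) by ring]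
  field_simp
  ring

/-- The sum of `f` over all orderings of the three arguments. -/
def symmSum {A M : Type*} [AddCommMonoid M] (f : A → A → A → M) (a b c : A) : M :=
  f a b c + f a c b + f b a c + f b c a + f c a b + f c b a

theorem sum_perm_fin_three {A M : Type*} [AddCommMonoid M] (f : A → A → A → M) (x : Fin 3 → A) :
    ∑ σ : Equiv.Perm (Fin 3), f (x (σ 0)) (x (σ 1)) (x (σ 2)) = symmSum f (x 0) (x 1) (x 2) := by
  have h : (univ : Finset (Equiv.Perm (Fin 3))) =
      {1, Equiv.swap 1 2, Equiv.swap 0 1, Equiv.swap 0 1 * Equiv.swap 1 2,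
        Equiv.swap 1 2 * Equiv.swap 0 1, Equiv.swap 0 2} := by decide
  rw [h, sum_insert (by decide), sum_insert (by decide), sum_insert (by decide),
    sum_insert (by decide), sum_insert (by decide), sum_singleton]
  simp only [symmSum, add_assoc]
  rfl

/-- The side contribution to the sum over the alcove of the product of two plane waves, the second
of which has its first two variables exchanged. -/
def sideContribution (q N a b : K) : K :=
  scattering q a b * (-(N * (b / (a - b))) - a * b / (a - b) ^ 2 -
    sideDefect q * (N - 2 * (b / (a - b))) + 2 * cornerExcess q)

/-- The corner contribution of two plane waves whose outer variables are exchanged. -/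
def exchangeCorner (q a b c : K) : K :=
  scattering q a b * scattering q a c * scattering q b c *
    (c ^ 2 / (a - c) ^ 2 + 2 * sideDefect q * (c / (a - c)) + cornerExcess q)

/-- The corner contribution of two plane waves whose variables differ by a left rotation. -/
def rotationCorner (q a b c : K) : K :=
  scattering q a b * scattering q a c * (b * c / ((b - a) * (c - a)) -
    sideDefect q * (b / (b - a) + c / (c - a)) + cornerExcess q)

/-- The corner contribution of two plane waves whose variables differ by a right rotation. -/
def rotationCorner' (q a b c : K) : K :=
  scattering q a c * scattering q b c * (c ^ 2 / ((c - a) * (c - b)) -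
    sideDefect q * (c / (c - a) + c / (c - b)) + cornerExcess q)

set_option maxHeartbeats 2000000 in
/-- The terms of the norm without a factor `m + 1`, that is, the value of the norm, as a polynomial
in `m`, at `m = -1`. -/
theorem symmSum_constant_terms {q a b c : K}
    (hab : a - b ≠ 0) (hac : a - c ≠ 0) (hbc : b - c ≠ 0)
    (h12 : a - q * b ≠ 0) (h21 : b - q * a ≠ 0) (h13 : a - q * c ≠ 0) (h31 : c - q * a ≠ 0)
    (h23 : b - q * c ≠ 0) (h32 : c - q * b ≠ 0) (hq : 1 + q ≠ 0) (hq2 : 1 + q + q ^ 2 ≠ 0) :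
    18 * cornerExcess q + 3 * (symmSum (fun a b _ => sideContribution q 0 a b) a b c +
      symmSum (exchangeCorner q) a b c +
      symmSum (rotationCorner q) a b c + symmSum (rotationCorner' q) a b c) =
    9 * (kernelU q a b * kernelU q a c + kernelU q a b * kernelU q b c +
      kernelU q a c * kernelU q b c) + 3 - 6 * (kernelU q a b + kernelU q a c + kernelU q b c) := by
  unfold symmSum sideContribution exchangeCorner rotationCorner rotationCorner' scattering kernelU
    sideDefect cornerExcess
  simp only [zero_mul, neg_zero, zero_sub]
  rw [show b - a = -(a - b) by ring, show c - a = -(a - c) by ring, show c - b = -(b - c) by ring]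
  field_simp
  ring

/-- The sum of all contributions to the squared norm of the Bethe wave function: six diagonal terms,
and three copies of each side and corner contribution. -/
theorem symmSum_contributions [CharZero K] {q a b c : K} (N : K)
    (hab : a - b ≠ 0) (hac : a - c ≠ 0) (hbc : b - c ≠ 0)
    (h12 : a - q * b ≠ 0) (h21 : b - q * a ≠ 0) (h13 : a - q * c ≠ 0) (h31 : c - q * a ≠ 0)
    (h23 : b - q * c ≠ 0) (h32 : c - q * b ≠ 0) (hq : 1 + q ≠ 0) (hq2 : 1 + q + q ^ 2 ≠ 0) :
    6 * ((N + 1) * (N + 2) / 2 - 3 * sideDefect q * (N + 1) + 3 * cornerExcess q) +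
      3 * (symmSum (fun a b _ => sideContribution q (N + 1) a b) a b c +
        symmSum (exchangeCorner q) a b c +
        symmSum (rotationCorner q) a b c + symmSum (rotationCorner' q) a b c) =
    3 * (N ^ 2 + 2 * N * (kernelU q a b + kernelU q a c + kernelU q b c) +
      3 * (kernelU q a b * kernelU q a c + kernelU q a b * kernelU q b c +
        kernelU q a c * kernelU q b c)) := by
  -- The part of the side contributions proportional to `N + 1` splits into three pair sums.
  have hlin : symmSum (fun a b _ => sideContribution q (N + 1) a b) a b c =
      symmSum (fun a b _ => sideContribution q 0 a b) a b c +
        (N + 1) * (2 * (kernelU q a b + kernelU q a c + kernelU q b c) - 3 + 6 * sideDefect q) := by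
    have e1 := scattering_pair_sum hab h12 h21 hq
    have e2 := scattering_pair_sum hac h13 h31 hq
    have e3 := scattering_pair_sum hbc h23 h32 hq
    unfold symmSum sideContribution
    linear_combination (N + 1) * (e1 + e2 + e3)
  have hc := symmSum_constant_terms hab hac hbc h12 h21 h13 h31 h23 h32 hq hq2
  rw [hlin]
  linear_combination hc

/-! ### The squared norm of a three-particle Bethe wave function -/

/-- The numbers `a`, `b`, `c` are distinct and nonzero, their scattering factors have neither zeros
nor poles, and they satisfy the Bethe equations `a ^ m * S(a, b) * S(a, c) = ζ`, etc. -/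
structure BetheTriple (q ζ : K) (m : ℕ) (a b c : K) : Prop where
  a_ne : a ≠ 0
  b_ne : b ≠ 0
  c_ne : c ≠ 0
  ab : a - b ≠ 0
  ac : a - c ≠ 0
  bc : b - c ≠ 0
  qab : a - q * b ≠ 0
  qba : b - q * a ≠ 0
  qac : a - q * c ≠ 0
  qca : c - q * a ≠ 0
  qbc : b - q * c ≠ 0
  qcb : c - q * b ≠ 0
  bethe_a : a ^ m * (scattering q a b * scattering q a c) = ζ
  bethe_b : b ^ m * (scattering q b a * scattering q b c) = ζ
  bethe_c : c ^ m * (scattering q c a * scattering q c b) = ζ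

theorem sub_ne_zero_symm {a b : K} (h : a - b ≠ 0) : b - a ≠ 0 :=
  sub_ne_zero.2 (sub_ne_zero.1 h).symm

namespace BetheTriple

variable {q ζ a b c : K} {m : ℕ}

theorem swap (h : BetheTriple q ζ m a b c) : BetheTriple q ζ m b a c :=
  ⟨h.b_ne, h.a_ne, h.c_ne, sub_ne_zero_symm h.ab, h.bc, h.ac, h.qba, h.qab, h.qbc, h.qcb,
    h.qac, h.qca, h.bethe_b, h.bethe_a, by rw [mul_comm (scattering q c b)]; exact h.bethe_c⟩

theorem rotate (h : BetheTriple q ζ m a b c) : BetheTriple q ζ m b c a :=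
  ⟨h.b_ne, h.c_ne, h.a_ne, h.bc, sub_ne_zero_symm h.ab, sub_ne_zero_symm h.ac, h.qbc, h.qcb, h.qba,
    h.qab, h.qca, h.qac, by rw [mul_comm (scattering q b c)]; exact h.bethe_b,
    by rw [mul_comm (scattering q c b)]; exact h.bethe_c, h.bethe_a⟩

theorem scattering_swap (h : BetheTriple q ζ m a b c) :
    scattering q b a = (scattering q a b)⁻¹ :=
  eq_inv_of_mul_eq_one_left (scattering_mul_swap h.qba h.qab)

theorem scattering_ne_zero (h : BetheTriple q ζ m a b c) : scattering q a b ≠ 0 :=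
  left_ne_zero_of_mul_eq_one (scattering_mul_swap h.qab h.qba)

/-- The ratio of two Bethe equations. -/
theorem div_pow (h : BetheTriple q ζ m a b c) :
    (a / b) ^ m = scattering q b c / (scattering q a b ^ 2 * scattering q a c) := by
  have hs := h.scattering_ne_zero
  have hs' := h.swap.rotate.scattering_ne_zero
  have e := h.bethe_a.trans h.bethe_b.symm
  have hb := pow_ne_zero m h.b_ne
  rw [h.scattering_swap] at e
  rw [_root_.div_pow, div_eq_div_iff hb (mul_ne_zero (pow_ne_zero 2 hs) hs')]
  field_simp at e
  linear_combination e

end BetheTriple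

/-- The coefficient function `C` in terms of the variables `a`, `b`, `c`. -/
def waveCoeff (q a b c : K) : K :=
  (a - q * b) / (a - b) * ((a - q * c) / (a - c)) * ((b - q * c) / (b - c))

/-- The coefficient function `C` at the inverses of `a`, `b`, `c`. -/
def waveCoeffInv (q a b c : K) : K :=
  (b - q * a) / (b - a) * ((c - q * a) / (c - a)) * ((c - q * b) / (c - b))

theorem waveCoeffInv_swap_left {q a b : K} (c : K) (hab : a - b ≠ 0) (h : b - q * a ≠ 0) :
    waveCoeffInv q b a c = scattering q a b * waveCoeffInv q a b c := by
  have h' : b - a * q ≠ 0 := by rwa [mul_comm a q]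
  unfold waveCoeffInv scattering
  rw [show b - a = -(a - b) by ring]
  generalize (c - q * a) / (c - a) = x
  generalize (c - q * b) / (c - b) = y
  field_simp

theorem waveCoeffInv_swap_right {q b c : K} (a : K) (hbc : b - c ≠ 0) (h : c - q * b ≠ 0) :
    waveCoeffInv q a c b = scattering q b c * waveCoeffInv q a b c := by
  have h' : c - b * q ≠ 0 := by rwa [mul_comm b q]
  unfold waveCoeffInv scattering
  rw [show c - b = -(b - c) by ring]
  generalize (c - q * a) / (c - a) = x
  generalize (b - q * a) / (b - a) = y
  field_simp

/-- `|C|²` does not depend on the order of the variables. -/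
theorem waveCoeff_mul_inv_swap_left (q a b c : K) :
    waveCoeff q b a c * waveCoeffInv q b a c = waveCoeff q a b c * waveCoeffInv q a b c := by
  unfold waveCoeff waveCoeffInv
  ring

theorem waveCoeff_mul_inv_swap_right (q a b c : K) :
    waveCoeff q a c b * waveCoeffInv q a c b = waveCoeff q a b c * waveCoeffInv q a b c := by
  unfold waveCoeff waveCoeffInv
  ring

/-- The weighted sum over the alcove of the plane wave in the variables `a`, `b`, `c`, with its
coefficient, times the complex conjugate of the plane wave in the variables `x`, `y`, `z`. -/
def wavePairing (q : K) (m : ℕ) (a b c x y z : K) : K :=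
  waveCoeff q a b c * waveCoeffInv q x y z *
    weightedTriangleSum (sideDefect q) (cornerExcess q) m (a / x) (a * b / (x * y))

theorem scattering_mul_sideTerm {q a b : K} (N : K) (hb : b ≠ 0) (hab : a - b ≠ 0) :
    scattering q a b * sideTerm (sideDefect q) (cornerExcess q) N (a / b) =
      sideContribution q N a b := by
  have e : a / b - 1 = (a - b) / b := by field_simp
  unfold sideTerm sideContribution
  rw [e]
  field_simp

namespace BetheTriple

variable {q ζ a b c : K} {m : ℕ}

theorem weighted_refl [CharZero K] (h : BetheTriple q ζ m a b c) :
    weightedTriangleSum (sideDefect q) (cornerExcess q) m (a / a) (a * b / (a * b)) =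
      ((m : K) + 1) * (m + 2) / 2 - 3 * sideDefect q * (m + 1) + 3 * cornerExcess q := by
  rw [div_self h.a_ne, div_self (mul_ne_zero h.a_ne h.b_ne), weightedTriangleSum_one_one]

theorem div_ne_one (h : BetheTriple q ζ m a b c) : a / b ≠ 1 := by
  rw [Ne, div_eq_one_iff_eq h.b_ne]
  exact sub_ne_zero.1 h.ab

/-- The contribution of an exchange of the first two variables. -/
theorem weighted_swap_left (h : BetheTriple q ζ m a b c) :
    scattering q a b *
        weightedTriangleSum (sideDefect q) (cornerExcess q) m (a / b) (a * b / (b * a)) =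
      sideContribution q (m + 1) a b + exchangeCorner q b c a := by
  have hs := h.scattering_ne_zero
  have hs' := h.swap.rotate.scattering_ne_zero
  have hc : cornerTerm (sideDefect q) (cornerExcess q) (a / b) 1 1 =
      a ^ 2 / (b - a) ^ 2 + 2 * sideDefect q * (a / (b - a)) + cornerExcess q := by
    have e : a / b - 1 = (a - b) / b := by have := h.b_ne; field_simp
    have := h.ab
    have := h.b_ne
    unfold cornerTerm
    rw [e, show b - a = -(a - b) by ring]
    field_simp
    ring
  rw [mul_comm b a, div_self (mul_ne_zero h.a_ne h.b_ne),
    weightedTriangleSum_one_right _ _ h.div_ne_one, mul_add,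
    scattering_mul_sideTerm _ h.b_ne h.ab, add_comm, add_right_inj, h.div_pow, hc]
  unfold exchangeCorner
  rw [h.scattering_swap, h.swap.rotate.scattering_swap]
  field_simp

/-- The contribution of an exchange of the last two variables. -/
theorem weighted_swap_right (h : BetheTriple q ζ m a b c) :
    scattering q b c *
        weightedTriangleSum (sideDefect q) (cornerExcess q) m (a / a) (a * b / (a * c)) =
      sideContribution q (m + 1) b c + exchangeCorner q c a b := by
  rw [← h.rotate.weighted_swap_left, div_self h.a_ne, mul_div_mul_left _ _ h.a_ne, mul_comm c b,
    div_self (mul_ne_zero h.b_ne h.c_ne), weightedTriangleSum_comm]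

/-- The contribution of an exchange of the outer variables. -/
theorem weighted_exchange (h : BetheTriple q ζ m a b c) :
    scattering q a b * scattering q a c * scattering q b c *
        weightedTriangleSum (sideDefect q) (cornerExcess q) m (a / c) (a * b / (c * b)) =
      sideContribution q (m + 1) c a + exchangeCorner q a b c := by
  have h' := h.swap.rotate
  have hs := h.scattering_ne_zero
  have hs' := h'.scattering_ne_zero
  have hs'' := h.rotate.scattering_ne_zero
  have hc : cornerTerm (sideDefect q) (cornerExcess q) 1 (a / c) (a / c) =
      c ^ 2 / (a - c) ^ 2 + 2 * sideDefect q * (c / (a - c)) + cornerExcess q := by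
    have e : 1 - a / c = -(a - c) / c := by have := h.c_ne; field_simp; ring
    have := h.ac
    have := h.c_ne
    unfold cornerTerm
    rw [e]
    field_simp
    ring
  rw [mul_div_mul_right _ _ h.b_ne,
    weightedTriangleSum_self _ _ h'.div_ne_one (div_ne_zero h.a_ne h.c_ne), mul_add, hc,
    h'.div_pow, inv_div, ← scattering_mul_sideTerm _ h.a_ne (sub_ne_zero_symm h.ac), add_comm]
  unfold exchangeCorner
  rw [add_left_inj, h'.scattering_swap, h.rotate.scattering_swap]
  field_simp

/-- The contribution of a left rotation of the variables. -/
theorem weighted_rotate (h : BetheTriple q ζ m a b c) :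
    scattering q a b * scattering q a c *
        weightedTriangleSum (sideDefect q) (cornerExcess q) m (a / b) (a * b / (b * c)) =
      rotationCorner q a b c + rotationCorner q b c a + rotationCorner q c a b := by
  have h' := h.swap.rotate
  have hs := h.scattering_ne_zero
  have hs' := h'.scattering_ne_zero
  have hs'' := h.rotate.scattering_ne_zero
  have ha := h.a_ne
  have hb := h.b_ne
  have hc := h.c_ne
  have hab := h.ab
  have hac := h.ac
  have hbc := h.bc
  have hne : a / b ≠ a / c := fun e => hbc (by
    rw [div_eq_div_iff hb hc] at e
    rw [mul_left_cancel₀ ha e, sub_self])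
  have e1 : a / b - 1 = (a - b) / b := by field_simp
  have e2 : a / c - 1 = (a - c) / c := by field_simp
  have e3 : a / b - a / c = -(a * (b - c)) / (b * c) := by field_simp; ring
  rw [mul_comm a b, mul_div_mul_left _ _ hb,
    weightedTriangleSum_of_ne _ _ hne h.div_ne_one h'.div_ne_one, h.div_pow, h'.div_pow]
  unfold cornerTerm rotationCorner
  rw [h.scattering_swap, h'.scattering_swap, h.rotate.scattering_swap,
    show a / c - a / b = -(a / b - a / c) by ring, show 1 - a / b = -(a / b - 1) by ring,
    show 1 - a / c = -(a / c - 1) by ring, e1, e2, e3, show b - a = -(a - b) by ring,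
    show c - a = -(a - c) by ring, show c - b = -(b - c) by ring]
  field_simp
  ring

/-- The contribution of a right rotation of the variables. -/
theorem weighted_rotate' (h : BetheTriple q ζ m a b c) :
    scattering q a c * scattering q b c *
        weightedTriangleSum (sideDefect q) (cornerExcess q) m (a / c) (a * b / (c * a)) =
      rotationCorner' q a b c + rotationCorner' q b c a + rotationCorner' q c a b := by
  have h' := h.swap.rotate
  have hs := h.scattering_ne_zero
  have hs' := h'.scattering_ne_zero
  have hs'' := h.rotate.scattering_ne_zero
  have ha := h.a_ne
  have hb := h.b_ne
  have hc := h.c_ne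
  have hab := h.ab
  have hac := h.ac
  have hbc := h.bc
  have hne : a / c ≠ b / c := fun e => hab (by rw [(div_left_inj' hc).1 e, sub_self])
  have e1 : a / c - 1 = (a - c) / c := by field_simp
  have e2 : b / c - 1 = (b - c) / c := by field_simp
  have e3 : a / c - b / c = (a - b) / c := by field_simp
  rw [mul_comm c a, mul_div_mul_left _ _ ha,
    weightedTriangleSum_of_ne _ _ hne h'.div_ne_one h.rotate.div_ne_one, h'.div_pow,
    h.rotate.div_pow]
  unfold cornerTerm rotationCorner'
  rw [h.scattering_swap, h'.scattering_swap, h.rotate.scattering_swap,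
    show b / c - a / c = -(a / c - b / c) by ring, show 1 - a / c = -(a / c - 1) by ring,
    show 1 - b / c = -(b / c - 1) by ring, e1, e2, e3, show b - a = -(a - b) by ring,
    show c - a = -(a - c) by ring, show c - b = -(b - c) by ring]
  field_simp
  ring

/-- The pairings of one plane wave with all plane waves of the Bethe wave function. -/
theorem symmSum_wavePairing [CharZero K] (h : BetheTriple q ζ m a b c) :
    symmSum (wavePairing q m a b c) a b c = waveCoeff q a b c * waveCoeffInv q a b c *
      (((m : K) + 1) * (m + 2) / 2 - 3 * sideDefect q * (m + 1) + 3 * cornerExcess q +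
        (sideContribution q (m + 1) a b + sideContribution q (m + 1) b c +
          sideContribution q (m + 1) c a) +
        (exchangeCorner q b c a + exchangeCorner q c a b + exchangeCorner q a b c) +
        (rotationCorner q a b c + rotationCorner q b c a + rotationCorner q c a b) +
        (rotationCorner' q a b c + rotationCorner' q b c a + rotationCorner' q c a b)) := by
  have c1 := waveCoeffInv_swap_left c h.ab h.qba
  have c2 := waveCoeffInv_swap_right a h.bc h.qcb
  have c3 : waveCoeffInv q b c a =
      scattering q a b * scattering q a c * waveCoeffInv q a b c := by
    rw [waveCoeffInv_swap_right b h.ac h.qca, c1]; ring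
  have c4 : waveCoeffInv q c a b =
      scattering q a c * scattering q b c * waveCoeffInv q a b c := by
    rw [waveCoeffInv_swap_left b h.ac h.qca, c2]; ring
  have c5 : waveCoeffInv q c b a =
      scattering q a b * scattering q a c * scattering q b c * waveCoeffInv q a b c := by
    rw [waveCoeffInv_swap_left a h.bc h.qcb, c3]; ring
  -- The factors `c1`, …, `c5` are the ratios of the coefficients of the second plane wave.
  unfold symmSum wavePairing
  rw [c1, c2, c3, c4, c5]
  linear_combination waveCoeff q a b c * waveCoeffInv q a b c *
    (h.weighted_refl + h.weighted_swap_left + h.weighted_swap_right + h.weighted_exchange +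
      h.weighted_rotate + h.weighted_rotate')

/-- The squared norm of the Bethe wave function, divided by `|C|²`, is a quadratic polynomial in
`m` whose coefficients are the elementary spanning-forest sums of the weights `u_q`. -/
theorem symmSum_symmSum_wavePairing [CharZero K] (h : BetheTriple q ζ m a b c)
    (hq : 1 + q ≠ 0) (hq2 : 1 + q + q ^ 2 ≠ 0) :
    symmSum (fun x y z => symmSum (wavePairing q m x y z) a b c) a b c =
      waveCoeff q a b c * waveCoeffInv q a b c *
      (3 * ((m : K) ^ 2 + 2 * m * (kernelU q a b + kernelU q a c + kernelU q b c) +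
      3 * (kernelU q a b * kernelU q a c + kernelU q a b * kernelU q b c +
        kernelU q a c * kernelU q b c))) := by
  rw [← symmSum_contributions (m : K) h.ab h.ac h.bc h.qab h.qba h.qac h.qca h.qbc h.qcb hq hq2]
  have d1 := waveCoeff_mul_inv_swap_right q a b c
  have d2 := waveCoeff_mul_inv_swap_left q a b c
  have d3 := (waveCoeff_mul_inv_swap_right q b a c).trans d2
  have d4 := (waveCoeff_mul_inv_swap_left q a c b).trans d1
  have d5 := (waveCoeff_mul_inv_swap_left q b c a).trans d3
  have p0 := h.symmSum_wavePairing
  have p1 := h.rotate.swap.rotate.rotate.symmSum_wavePairing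
  have p2 := h.swap.symmSum_wavePairing
  have p3 := h.rotate.symmSum_wavePairing
  have p4 := h.rotate.rotate.symmSum_wavePairing
  have p5 := h.rotate.swap.symmSum_wavePairing
  rw [d1] at p1
  rw [d2] at p2
  rw [d3] at p3
  rw [d4] at p4
  rw [d5] at p5
  generalize waveCoeff q a b c * waveCoeffInv q a b c = D at *
  unfold symmSum at *
  linear_combination p0 + p1 + p2 + p3 + p4 + p5

end BetheTriple

end Algebra

/-! ### The phase function `v_q` -/

section Phase

variable {q : ℝ}

theorem one_sub_mul_cos_pos (h1 : -1 < q) (h2 : q < 1) (θ : ℝ) : 0 < 1 - q * Real.cos θ := by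
  have h : |q * Real.cos θ| < 1 := by
    rw [abs_mul]
    exact mul_lt_one_of_nonneg_of_lt_one_left (abs_nonneg _) (abs_lt.2 ⟨h1, h2⟩)
      (Real.abs_cos_le_one θ)
  linarith [(abs_lt.1 h).2]

theorem v_eq_add_arctan (h1 : -1 < q) (h2 : q < 1) (θ : ℝ) :
    v q θ = θ + 2 * Real.arctan (q * Real.sin θ / (1 - q * Real.cos θ)) := by
  -- Both sides vanish at `0`, and the right-hand side is a primitive of `u q`.
  have hd (x : ℝ) : HasDerivAt
      (fun x => x + 2 * Real.arctan (q * Real.sin x / (1 - q * Real.cos x))) (u q x) x := by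
    have hp := one_sub_mul_cos_pos h1 h2 x
    have hs : HasDerivAt (fun x => q * Real.sin x) (q * Real.cos x) x :=
      (Real.hasDerivAt_sin x).const_mul q
    have hc : HasDerivAt (fun x => 1 - q * Real.cos x) (q * Real.sin x) x := by
      simpa using ((Real.hasDerivAt_cos x).const_mul q).const_sub 1
    have h := (hasDerivAt_id x).add ((hs.div hc hp.ne').arctan.const_mul 2)
    refine h.congr_deriv ?_
    have hu := u_pos h1 h2 x
    have hden : 1 - 2 * q * Real.cos x + q ^ 2 ≠ 0 := by
      intro h0
      rw [u, h0, div_zero] at hu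
      exact lt_irrefl _ hu
    have e : (1 - q * Real.cos x) ^ 2 + (q * Real.sin x) ^ 2 = 1 - 2 * q * Real.cos x + q ^ 2 := by
      linear_combination q ^ 2 * Real.sin_sq_add_cos_sq x
    have e' : 1 + (q * Real.sin x / (1 - q * Real.cos x)) ^ 2 =
        (1 - 2 * q * Real.cos x + q ^ 2) / (1 - q * Real.cos x) ^ 2 := by
      rw [← e]
      have := hp.ne'
      field_simp
    simp only [Pi.div_apply]
    rw [e']
    unfold u
    have := hp.ne'
    field_simp
    linear_combination (-(2 * q ^ 2)) * Real.sin_sq_add_cos_sq x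
  have h := intervalIntegral.integral_eq_sub_of_hasDerivAt (fun x _ => hd x)
    ((u_continuous h1 h2).intervalIntegrable 0 θ)
  rw [v, h]
  simp

theorem v_neg (h1 : -1 < q) (h2 : q < 1) (θ : ℝ) : v q (-θ) = -v q θ := by
  rw [v_eq_add_arctan h1 h2, v_eq_add_arctan h1 h2, Real.sin_neg, Real.cos_neg, mul_neg, neg_div,
    Real.arctan_neg]
  ring

theorem v_add_two_pi (h1 : -1 < q) (h2 : q < 1) (θ : ℝ) :
    v q (θ + 2 * Real.pi) = v q θ + 2 * Real.pi := by
  rw [v_eq_add_arctan h1 h2, v_eq_add_arctan h1 h2, Real.sin_add_two_pi, Real.cos_add_two_pi]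
  ring

theorem u_neg (θ : ℝ) : u q (-θ) = u q θ := by simp [u]

theorem exp_two_arctan (t : ℝ) :
    Complex.exp (Complex.I * (2 * Real.arctan t : ℝ)) * (1 - t * Complex.I) =
      1 + t * Complex.I := by
  have hc : (Real.cos (Real.arctan t) : ℂ) ≠ 0 :=
    Complex.ofReal_ne_zero.2 (Real.cos_arctan_pos t).ne'
  have ht : (Real.sin (Real.arctan t) : ℂ) = t * Real.cos (Real.arctan t) := by
    rw [← Complex.ofReal_mul, ← Real.tan_mul_cos (Real.cos_arctan_pos t).ne', Real.tan_arctan]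
  have hp : (Real.sin (Real.arctan t) : ℂ) ^ 2 + (Real.cos (Real.arctan t) : ℂ) ^ 2 = 1 := by
    exact_mod_cast Real.sin_sq_add_cos_sq (Real.arctan t)
  have he : Complex.exp (Complex.I * (2 * Real.arctan t : ℝ)) =
      (Real.cos (Real.arctan t) + Real.sin (Real.arctan t) * Complex.I) ^ 2 := by
    rw [Complex.ofReal_cos, Complex.ofReal_sin, ← Complex.exp_mul_I, ← Complex.exp_nat_mul]
    push_cast
    ring_nf
  rw [ht] at hp he
  rw [he]
  generalize (Real.cos (Real.arctan t) : ℂ) = c at *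
  linear_combination (1 + t * Complex.I) * hp -
    (1 + t * Complex.I) * c ^ 2 * t ^ 2 * Complex.I_sq

/-- The point `e ^ (i θ)` of the unit circle. -/
noncomputable def phase (θ : ℝ) : ℂ := Complex.exp (Complex.I * θ)

theorem phase_ne_zero (θ : ℝ) : phase θ ≠ 0 := Complex.exp_ne_zero _

theorem phase_add (α β : ℝ) : phase (α + β) = phase α * phase β := by
  simp [phase, mul_add, Complex.exp_add]

theorem phase_neg (α : ℝ) : phase (-α) = (phase α)⁻¹ := by
  simp [phase, Complex.exp_neg]

theorem phase_sub (α β : ℝ) : phase (α - β) = phase α / phase β := by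
  rw [sub_eq_add_neg, phase_add, phase_neg, div_eq_mul_inv]

theorem phase_nat_mul (k : ℕ) (α : ℝ) : phase (k * α) = phase α ^ k := by
  rw [phase, phase, ← Complex.exp_nat_mul]
  push_cast
  ring_nf

theorem phase_sum {ι : Type*} (s : Finset ι) (f : ι → ℝ) :
    phase (∑ i ∈ s, f i) = ∏ i ∈ s, phase (f i) := by
  simp only [phase, Complex.ofReal_sum, mul_sum, Complex.exp_sum]

theorem phase_two_pi_mul_int (k : ℤ) : phase (2 * Real.pi * k) = 1 := by
  rw [phase, ← Complex.exp_int_mul_two_pi_mul_I k]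
  push_cast
  ring_nf

theorem norm_phase (θ : ℝ) : ‖phase θ‖ = 1 := by
  rw [phase, mul_comm, Complex.norm_exp_ofReal_mul_I]

theorem conj_phase (θ : ℝ) : (starRingEnd ℂ) (phase θ) = (phase θ)⁻¹ := by
  rw [← phase_neg, phase, phase, ← Complex.exp_conj]
  simp

theorem phase_eq_cos_add_sin (θ : ℝ) :
    phase θ = Real.cos θ + Real.sin θ * Complex.I := by
  rw [phase, mul_comm, Complex.exp_mul_I, Complex.ofReal_cos, Complex.ofReal_sin]

/-- Distinct phases: a difference strictly between `0` and `2π` is not a multiple of `2π`. -/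
theorem phase_sub_ne_zero {α β : ℝ} (h0 : 0 < α - β) (h1 : α - β < 2 * Real.pi) :
    phase α - phase β ≠ 0 := by
  intro h
  have h' : phase (α - β) = 1 := by
    rw [phase_sub, sub_eq_zero.1 h, div_self (phase_ne_zero β)]
  rw [phase, Complex.exp_eq_one_iff] at h'
  obtain ⟨k, hk⟩ := h'
  have hk' : α - β = k * (2 * Real.pi) := by
    have : ((α - β : ℝ) : ℂ) = ((k * (2 * Real.pi) : ℝ) : ℂ) := by
      apply mul_left_cancel₀ Complex.I_ne_zero
      rw [hk]
      push_cast
      ring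
    exact_mod_cast this
  have hpi := Real.pi_pos
  rw [hk'] at h0 h1
  have k0 : (0 : ℝ) < k := pos_of_mul_pos_left h0 (by positivity)
  have k1 : (k : ℝ) < 1 := by
    by_contra hge
    push Not at hge
    nlinarith
  have k0' : 0 < k := by exact_mod_cast k0
  have k1' : k < 1 := by exact_mod_cast k1
  omega

theorem phase_sub_mul_ne_zero (h1 : -1 < q) (h2 : q < 1) (α β : ℝ) :
    phase α - (q : ℂ) * phase β ≠ 0 := by
  intro h
  have h' := congrArg norm (sub_eq_zero.1 h)
  rw [norm_mul, norm_phase, norm_phase, mul_one, Complex.norm_real, Real.norm_eq_abs] at h'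
  have := abs_lt.2 ⟨h1, h2⟩
  linarith

/-- The exponential of the phase function `v_q` is, up to sign, the scattering factor. -/
theorem phase_v_sub (h1 : -1 < q) (h2 : q < 1) (α β : ℝ) :
    phase (v q (α - β)) =
      (phase α - (q : ℂ) * phase β) / (phase β - (q : ℂ) * phase α) := by
  have hp := one_sub_mul_cos_pos h1 h2 (α - β)
  have hp' : (1 - q * Real.cos (α - β) : ℂ) ≠ 0 := by exact_mod_cast hp.ne'
  have hz : phase α = phase (α - β) * phase β := by rw [← phase_add, sub_add_cancel]
  have hβ := phase_ne_zero β
  have hv : phase (v q (α - β)) * (1 - q * phase (α - β)) = phase (α - β) - q := by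
    have ha := exp_two_arctan (q * Real.sin (α - β) / (1 - q * Real.cos (α - β)))
    have hi := mul_inv_cancel₀ (phase_ne_zero (α - β))
    rw [← phase_neg, phase_eq_cos_add_sin (-(α - β)), Real.cos_neg, Real.sin_neg] at hi
    rw [← phase] at ha
    rw [v_eq_add_arctan h1 h2, phase_add]
    generalize phase (2 * Real.arctan (q * Real.sin (α - β) / (1 - q * Real.cos (α - β)))) = E at *
    rw [Complex.ofReal_neg] at hi
    rw [Complex.ofReal_div, Complex.ofReal_mul, Complex.ofReal_sub, Complex.ofReal_mul,
      Complex.ofReal_one] at ha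
    have hz' := phase_eq_cos_add_sin (α - β)
    generalize phase (α - β) = z at *
    generalize (Real.cos (α - β) : ℂ) = c at *
    generalize (Real.sin (α - β) : ℂ) = s at *
    field_simp at ha
    rw [hz'] at hi ⊢
    linear_combination (c + s * Complex.I) * ha + (-(q : ℂ)) * hi
  rw [eq_div_iff (phase_sub_mul_ne_zero h1 h2 β α), hz]
  linear_combination phase β * hv

/-- The function `u_q` in exponential variables. -/
theorem ofReal_u_sub (α β : ℝ) :
    (u q (α - β) : ℂ) = kernelU (q : ℂ) (phase α) (phase β) := by
  have hz : phase α = phase (α - β) * phase β := by rw [← phase_add, sub_add_cancel]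
  have hi := mul_inv_cancel₀ (phase_ne_zero (α - β))
  have hz' := phase_eq_cos_add_sin (α - β)
  rw [← phase_neg, phase_eq_cos_add_sin (-(α - β)), Real.cos_neg, Real.sin_neg] at hi
  have hden : (phase α - (q : ℂ) * phase β) * (phase β - (q : ℂ) * phase α) =
      (phase α * phase β) * (1 - 2 * q * Real.cos (α - β) + q ^ 2) := by
    rw [hz]
    generalize phase (α - β) = z at *
    subst hz'
    push_cast at *
    linear_combination phase β ^ 2 * q * hi
  have hne := mul_ne_zero (phase_ne_zero α) (phase_ne_zero β)
  rw [kernelU, hden, mul_comm (1 - (q : ℂ) ^ 2), mul_div_mul_left _ _ hne, u]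
  push_cast
  rfl

end Phase

/-! ### Critical points of the Morse function -/

section Morse

variable {n : ℕ} {q : ℝ}

/-- The gradient of a sum of even pair potentials over `j < k` is a full sum of odd forces. -/
theorem sum_Ioi_mul_single_sub_single {f : Fin n → Fin n → ℝ}
    (hf : ∀ j k, f k j = -f j k) (i : Fin n) :
    ∑ j, ∑ k ∈ Ioi j, f j k *
      ((Pi.single i (1 : ℝ) : Fin n → ℝ) j - (Pi.single i (1 : ℝ) : Fin n → ℝ) k) =
      ∑ k, f i k := by
  have hii : f i i = 0 := by linarith [hf i i]
  have hA : ∑ j, ∑ k ∈ Ioi j, f j k * (Pi.single i (1 : ℝ) : Fin n → ℝ) j =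
      ∑ k ∈ Ioi i, f i k := by
    rw [sum_eq_single i (fun j _ hj => by simp [hj]) (by simp)]
    simp
  have hB : ∑ j, ∑ k ∈ Ioi j, f j k * (Pi.single i (1 : ℝ) : Fin n → ℝ) k =
      ∑ j ∈ Iio i, f j i := by
    rw [sum_comm' (t' := univ) (s' := fun k => Iio k) (by simp),
      sum_eq_single i (fun j _ hj => by simp [hj]) (by simp)]
    simp
  have hIoi : Ioi i = univ.filter (i < ·) := by ext; simp
  have hIio : Iio i = univ.filter (· < i) := by ext; simp
  simp only [mul_sub, sum_sub_distrib]
  rw [hA, hB, hIoi, hIio, sum_filter, sum_filter, ← sum_sub_distrib]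
  refine sum_congr rfl fun k _ => ?_
  rcases lt_trichotomy i k with h | h | h
  · simp [h, h.not_gt]
  · subst h
    simp [hii]
  · simp [h, h.not_gt, hf k i]

theorem hasDerivAt_add_smul_apply (ξ w : Fin n → ℝ) (j : Fin n) :
    HasDerivAt (fun t : ℝ => (ξ + t • w) j) (w j) 0 := by
  simpa using ((hasDerivAt_id (0 : ℝ)).mul_const (w j)).const_add (ξ j)

theorem hasLineDerivAt_morse (m : ℕ) (h1 : -1 < q) (h2 : q < 1) (lam ξ w : Fin n → ℝ) :
    HasLineDerivAt ℝ (morse m q lam)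
      (∑ j, ∑ k ∈ Ioi j, v q (ξ j - ξ k) * (w j - w k) +
        ∑ j, (m * ξ j - 2 * Real.pi * (rho n j + lam j)) * w j) ξ w := by
  unfold HasLineDerivAt morse
  have hc := hasDerivAt_add_smul_apply ξ w
  refine HasDerivAt.add (HasDerivAt.fun_sum fun j _ => HasDerivAt.fun_sum fun k _ => ?_)
    (HasDerivAt.fun_sum fun j _ => ?_)
  · exact (w_hasDerivAt h1 h2 (ξ j - ξ k)).comp_of_eq 0 ((hc j).sub (hc k)) (by simp)
  · refine ((((hc j).pow 2).const_mul ((m : ℝ) / 2)).sub ((hc j).const_mul _)).congr_deriv ?_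
    simp
    ring

/-- The `k`-th partial derivative of the Morse function. -/
noncomputable def morseGradient (m : ℕ) (q : ℝ) (lam ξ : Fin n → ℝ) (k : Fin n) : ℝ :=
  ∑ i, v q (ξ k - ξ i) + m * ξ k - 2 * Real.pi * (rho n k + lam k)

theorem hasLineDerivAt_morse_single (m : ℕ) (h1 : -1 < q) (h2 : q < 1) (lam ξ : Fin n → ℝ)
    (k : Fin n) :
    HasLineDerivAt ℝ (morse m q lam) (morseGradient m q lam ξ k) ξ (Pi.single k 1) := by
  have h := hasLineDerivAt_morse m h1 h2 lam ξ (Pi.single k 1)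
  have hs : ∑ j, (m * ξ j - 2 * Real.pi * (rho n j + lam j)) *
      (Pi.single k (1 : ℝ) : Fin n → ℝ) j =
      m * ξ k - 2 * Real.pi * (rho n k + lam k) := by
    rw [sum_eq_single k (fun j _ hj => by simp [hj]) (by simp), Pi.single_eq_same, mul_one]
  rw [sum_Ioi_mul_single_sub_single (f := fun j k => v q (ξ j - ξ k))
    (fun j k => by rw [← v_neg h1 h2, neg_sub]), hs, ← add_sub_assoc] at h
  exact h

theorem morseGradient_node {m : ℕ} (hm : 1 ≤ m) (h1 : -1 < q) (h2 : q < 1) (lam : Fin n → ℝ)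
    (k : Fin n) : morseGradient m q lam (node hm h1 h2 lam) k = 0 := by
  have h := hasLineDerivAt_morse_single m h1 h2 lam (node hm h1 h2 lam) k
  refine IsLocalMin.hasDerivAt_eq_zero (Filter.Eventually.of_forall fun t => ?_) h
  rw [zero_smul, add_zero]
  exact node_spec hm h1 h2 lam _

theorem hessian_apply (m : ℕ) (h1 : -1 < q) (h2 : q < 1) (lam ξ : Fin n → ℝ) (j k : Fin n) :
    hessian m q lam ξ j k =
      ∑ i, u q (ξ k - ξ i) * ((Pi.single j (1 : ℝ) : Fin n → ℝ) k -
        (Pi.single j (1 : ℝ) : Fin n → ℝ) i) + m * (Pi.single j (1 : ℝ) : Fin n → ℝ) k := by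
  have e : (fun η => lineDeriv ℝ (morse m q lam) η (Pi.single k 1)) =
      fun η => morseGradient m q lam η k :=
    funext fun η => (hasLineDerivAt_morse_single m h1 h2 lam η k).lineDeriv
  rw [hessian, Matrix.of_apply, e]
  refine HasLineDerivAt.lineDeriv ?_
  have hc := hasDerivAt_add_smul_apply ξ (Pi.single j 1)
  unfold HasLineDerivAt morseGradient
  refine (HasDerivAt.add (HasDerivAt.fun_sum fun i _ => ?_) ((hc k).const_mul _)).sub_const _
  exact (v_hasDerivAt h1 h2 (ξ k - ξ i)).comp_of_eq 0 ((hc k).sub (hc i)) (by simp)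

/-- The coordinates of a weight in the alcove decrease by integral steps, by at most `m` in all. -/
theorem exists_nat_of_mem_alcove {m : ℕ} {μ : Fin n → ℝ} (hμ : μ ∈ alcove m n) {j k : Fin n}
    (hjk : j < k) : ∃ d : ℕ, d ≤ m ∧ μ j - μ k = d := by
  obtain ⟨l, hl, rfl⟩ := hμ
  refine ⟨∑ i : Fin (n - 1), if (j : ℕ) ≤ i ∧ (i : ℕ) < k then l i else 0,
    (sum_le_sum fun i _ => by split_ifs <;> simp).trans hl, ?_⟩
  rw [Finset.sum_apply, Finset.sum_apply, ← sum_sub_distrib]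
  push_cast
  refine sum_congr rfl fun i _ => ?_
  have hjk' : (j : ℕ) < k := hjk
  simp only [Pi.smul_apply, smul_eq_mul, fundamentalWeight]
  by_cases hj : (j : ℕ) ≤ i
  · by_cases hk : (k : ℕ) ≤ i
    · simp [hj, hk]
    · simp [hj, hk, not_le.1 hk]
      ring
  · simp [hj, show ¬ (k : ℕ) ≤ i by omega]

theorem rho_sub_rho (j k : Fin n) : rho n j - rho n k = (k : ℕ) - (j : ℕ) := by
  unfold rho
  ring

/-- At a critical point the coordinates are distinct modulo `2π` and decreasing: by monotonicity
of `v_q` and its quasi-periodicity, a difference outside the interval `(0, 2π)` would make the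
difference of two components of the gradient nonzero. -/
theorem sub_mem_Ioo_of_morseGradient_eq_zero {m : ℕ} (h1 : -1 < q) (h2 : q < 1)
    {lam ξ : Fin n → ℝ} (hlam : lam ∈ alcove m n) (hξ : ∀ k, morseGradient m q lam ξ k = 0)
    {j k : Fin n} (hjk : j < k) : ξ j - ξ k ∈ Set.Ioo 0 (2 * Real.pi) := by
  obtain ⟨d, hd, hlam'⟩ := exists_nat_of_mem_alcove hlam hjk
  have hpi := Real.pi_pos
  have hjk' : ((j : ℕ) : ℝ) + 1 ≤ (k : ℕ) := by exact_mod_cast hjk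
  have hkn : ((k : ℕ) : ℝ) + 1 ≤ n := by exact_mod_cast k.2
  have hj0 : (0 : ℝ) ≤ (j : ℕ) := Nat.cast_nonneg _
  have hd0 : (0 : ℝ) ≤ d := Nat.cast_nonneg _
  have hd' : (d : ℝ) ≤ m := by exact_mod_cast hd
  have hm0 : (0 : ℝ) ≤ m := Nat.cast_nonneg _
  have key : ∑ i, (v q (ξ j - ξ i) - v q (ξ k - ξ i)) + m * (ξ j - ξ k) =
      2 * Real.pi * (((k : ℕ) - (j : ℕ)) + d) := by
    have ej := hξ j
    have ek := hξ k
    unfold morseGradient at ej ek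
    rw [← rho_sub_rho, ← hlam', sum_sub_distrib]
    linear_combination ej - ek
  constructor
  · by_contra hle
    push Not at hle
    have hs : ∑ i, (v q (ξ j - ξ i) - v q (ξ k - ξ i)) ≤ 0 :=
      sum_nonpos fun i _ => sub_nonpos.2 (v_mono h1 h2 (by linarith))
    have hm' : (m : ℝ) * (ξ j - ξ k) ≤ 0 := mul_nonpos_of_nonneg_of_nonpos hm0 hle
    have : 0 < 2 * Real.pi * (((k : ℕ) - (j : ℕ)) + d : ℝ) := by
      apply mul_pos (by positivity)
      linarith
    linarith
  · by_contra hge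
    push Not at hge
    -- Each of the `n` force differences is at least one full period.
    have hs : ∑ _i : Fin n, 2 * Real.pi ≤ ∑ i, (v q (ξ j - ξ i) - v q (ξ k - ξ i)) := by
      refine sum_le_sum fun i _ => ?_
      have := v_mono h1 h2 (show ξ k - ξ i + 2 * Real.pi ≤ ξ j - ξ i by linarith)
      rw [v_add_two_pi h1 h2] at this
      linarith
    rw [sum_const, card_univ, Fintype.card_fin, nsmul_eq_mul] at hs
    have hm' : (m : ℝ) * (2 * Real.pi) ≤ m * (ξ j - ξ k) := mul_le_mul_of_nonneg_left hge hm0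
    have : 2 * Real.pi * (((k : ℕ) - (j : ℕ)) + d : ℝ) < 2 * Real.pi * (n + m) := by
      apply mul_lt_mul_of_pos_left _ (by positivity)
      linarith
    linarith

/-- The exponential form of the critical point equations. -/
theorem bethe_equation {m : ℕ} (h1 : -1 < q) (h2 : q < 1) {lam ξ : Fin n → ℝ} {k : Fin n}
    (hξ : morseGradient m q lam ξ k = 0) :
    phase (ξ k) ^ m * ∏ i, (phase (ξ k) - (q : ℂ) * phase (ξ i)) /
      (phase (ξ i) - (q : ℂ) * phase (ξ k)) = phase (2 * Real.pi * (rho n k + lam k)) := by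
  have h := sub_eq_zero.1 hξ
  rw [← h, phase_add, phase_sum, phase_nat_mul, mul_comm]
  simp only [phase_v_sub h1 h2]

/-- The right-hand sides of all Bethe equations agree. -/
theorem phase_rho_add_eq {m : ℕ} {lam : Fin n → ℝ} (hlam : lam ∈ alcove m n) {j k : Fin n}
    (hjk : j < k) :
    phase (2 * Real.pi * (rho n k + lam k)) = phase (2 * Real.pi * (rho n j + lam j)) := by
  obtain ⟨d, -, hlam'⟩ := exists_nat_of_mem_alcove hlam hjk
  have e : 2 * Real.pi * (rho n j + lam j) =
      2 * Real.pi * (((k : ℕ) - (j : ℕ) + d : ℤ) : ℝ) + 2 * Real.pi * (rho n k + lam k) := by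
    push_cast
    rw [← rho_sub_rho, ← hlam']
    ring
  rw [e, phase_add, phase_two_pi_mul_int, one_mul]

end Morse

/-! ### The case of three variables -/

theorem cFun_factor (q α β : ℝ) :
    (1 - (q : ℂ) * Complex.exp (-(Complex.I * ((α - β : ℝ) : ℂ)))) /
      (1 - Complex.exp (-(Complex.I * ((α - β : ℝ) : ℂ)))) =
    (phase α - (q : ℂ) * phase β) / (phase α - phase β) := by
  have e : Complex.exp (-(Complex.I * ((α - β : ℝ) : ℂ))) = phase β / phase α := by
    rw [← phase_sub, ← neg_sub α β, phase, Complex.ofReal_neg, mul_neg]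
  have ha := phase_ne_zero α
  rw [e, ← mul_div_mul_left _ _ ha]
  congr 1 <;> field_simp

theorem cFun_three (q : ℝ) (ξ : Fin 3 → ℝ) :
    cFun q ξ = waveCoeff (q : ℂ) (phase (ξ 0)) (phase (ξ 1)) (phase (ξ 2)) := by
  have h0 : Ioi (0 : Fin 3) = {1, 2} := by decide
  have h1 : Ioi (1 : Fin 3) = {2} := by decide
  have h2 : Ioi (2 : Fin 3) = ∅ := by decide
  unfold cFun waveCoeff
  simp only [cFun_factor, Fin.prod_univ_three, h0, h1, h2, prod_empty, prod_singleton, mul_one]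
  rw [prod_insert (by decide), prod_singleton]

theorem conj_waveCoeff_phase (q α β γ : ℝ) :
    (starRingEnd ℂ) (waveCoeff (q : ℂ) (phase α) (phase β) (phase γ)) =
      waveCoeffInv (q : ℂ) (phase α) (phase β) (phase γ) := by
  have e (x y : ℝ) : ((phase x)⁻¹ - (q : ℂ) * (phase y)⁻¹) / ((phase x)⁻¹ - (phase y)⁻¹) =
      (phase y - (q : ℂ) * phase x) / (phase y - phase x) := by
    have hx := phase_ne_zero x
    have hy := phase_ne_zero y
    rw [← mul_div_mul_left _ _ (mul_ne_zero hx hy)]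
    congr 1 <;> field_simp
  simp only [waveCoeff, waveCoeffInv, map_mul, map_div₀, map_sub, conj_phase,
    Complex.conj_ofReal, e]

theorem symmSum_mul_symmSum {A R : Type*} [CommSemiring R] (f g : A → A → A → R) (a b c : A) :
    symmSum f a b c * symmSum g a b c =
      symmSum (fun x y z => symmSum (fun x' y' z' => f x y z * g x' y' z') a b c) a b c := by
  simp only [symmSum, mul_add, add_mul]
  ac_rfl

theorem sum_symmSum {A M ι : Type*} [AddCommMonoid M] (s : Finset ι) (f : ι → A → A → A → M)
    (a b c : A) :
    ∑ i ∈ s, symmSum (f i) a b c = symmSum (fun x y z => ∑ i ∈ s, f i x y z) a b c := by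
  simp only [symmSum, sum_add_distrib]

/-- The dominant weight `i ω_1 + j ω_2` of `SU(3)`. -/
noncomputable def weightThree (i j : ℕ) : Fin 3 → ℝ :=
  ![(2 * i + j) / 3, ((j : ℝ) - i) / 3, -(i + 2 * j) / 3]

theorem weightThree_eq (l : Fin 2 → ℕ) :
    ∑ j, (l j : ℝ) • fundamentalWeight 3 j = weightThree (l 0) (l 1) := by
  have h : ∑ j : Fin (3 - 1), (l j : ℝ) • fundamentalWeight 3 j =
    (l 0 : ℝ) • fundamentalWeight 3 0 + (l 1 : ℝ) • fundamentalWeight 3 1 := Fin.sum_univ_two _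
  rw [h]
  ext k
  fin_cases k <;> simp [weightThree, fundamentalWeight] <;> ring

theorem weightThree_sub_zero_one (i j : ℕ) : weightThree i j 0 - weightThree i j 1 = i := by
  simp [weightThree]
  ring

theorem weightThree_sub_one_two (i j : ℕ) : weightThree i j 1 - weightThree i j 2 = j := by
  simp [weightThree]
  ring

theorem weightThree_sub_zero_two (i j : ℕ) :
    weightThree i j 0 - weightThree i j 2 = (i + j : ℕ) := by
  simp [weightThree]
  ring

/-- The alcove of `SU(3)`, sliced by the first part `k = i + j` of the associated partition. -/
theorem sum_alcove_three {M : Type*} [AddCommMonoid M] (m : ℕ) (f : (Fin 3 → ℝ) → M) :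
    ∑ μ ∈ (alcove_finite m 3).toFinset, f μ =
      ∑ k ∈ range (m + 1), ∑ i ∈ range (k + 1), f (weightThree i (k - i)) := by
  rw [sum_sigma']
  symm
  refine sum_nbij (fun p => weightThree p.2 (p.1 - p.2)) ?_ ?_ ?_ (fun _ _ => rfl)
  · rintro ⟨k, i⟩ h
    simp only [mem_sigma, mem_range] at h
    rw [Set.Finite.mem_toFinset]
    refine ⟨(![i, k - i] : Fin 2 → ℕ), ?_, (weightThree_eq ![i, k - i]).symm⟩
    have e : ∑ j : Fin (3 - 1), (![i, k - i] : Fin 2 → ℕ) j = i + (k - i) := Fin.sum_univ_two _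
    rw [e]
    omega
  · rintro ⟨k, i⟩ h ⟨k', i'⟩ h' e
    simp only [coe_sigma, Set.mem_sigma_iff, coe_range, Set.mem_Iio] at h h'
    have e0 := weightThree_sub_zero_one i (k - i)
    have e1 := weightThree_sub_one_two i (k - i)
    have e' : weightThree i (k - i) = weightThree i' (k' - i') := e
    rw [e', weightThree_sub_zero_one, Nat.cast_inj] at e0
    rw [e', weightThree_sub_one_two, Nat.cast_inj] at e1
    obtain rfl : k = k' := by omega
    rw [e0]
  · intro μ h
    rw [Set.Finite.coe_toFinset] at h
    obtain ⟨l, hl, rfl⟩ := h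
    have e : ∑ j : Fin (3 - 1), l j = l 0 + l 1 := Fin.sum_univ_two _
    refine ⟨⟨l 0 + l 1, l 0⟩, ?_, ?_⟩
    · simp only [coe_sigma, Set.mem_sigma_iff, coe_range, Set.mem_Iio]
      omega
    · simp only [Nat.add_sub_cancel_left]
      exact (weightThree_eq l).symm

/-- The orthogonality weight as a function of the Dynkin labels: `1` in the interior, lowered by
`s` for each side and raised by `t` at a corner. -/
def alcoveWeight {K : Type*} [Field K] (s t : K) (m i j : ℕ) : K :=
  1 - s * ((if i = 0 then 1 else 0) + (if j = 0 then 1 else 0) + if i + j = m then 1 else 0) +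
    t * ((if i = 0 ∧ j = 0 then 1 else 0) + (if i = m ∧ j = 0 then 1 else 0) +
      if i = 0 ∧ j = m then 1 else 0)

theorem sum_alcoveWeight {K : Type*} [Field K] (s t : K) (m : ℕ) (a b : K) :
    ∑ k ∈ range (m + 1), ∑ i ∈ range (k + 1), alcoveWeight s t m i (k - i) * (a ^ i * b ^ (k - i)) =
      weightedTriangleSum s t m a b := by
  have hin (k : ℕ) : ∑ i ∈ range (k + 1), alcoveWeight s t m i (k - i) * (a ^ i * b ^ (k - i)) =
      ∑ i ∈ range (k + 1), a ^ i * b ^ (k - i) - s * (b ^ k + a ^ k +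
        if k = m then ∑ i ∈ range (k + 1), a ^ i * b ^ (k - i) else 0) +
      t * ((if k = 0 then 1 else 0) + (if k = m then a ^ k else 0) +
        if k = m then b ^ k else 0) := by
    have s1 : ∑ i ∈ range (k + 1), (if i = 0 then 1 else 0) * (a ^ i * b ^ (k - i)) = b ^ k := by
      rw [sum_eq_single 0 (fun i _ hi => by simp [hi]) (by simp)]
      simp
    have s2 : ∑ i ∈ range (k + 1), (if k - i = 0 then 1 else 0) * (a ^ i * b ^ (k - i)) =
        a ^ k := by
      rw [sum_eq_single k (fun i hi hne => ?_) (by simp)]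
      · simp
      · have : k - i ≠ 0 := by have := mem_range.1 hi; omega
        simp [this]
    have s3 : ∑ i ∈ range (k + 1), (if i + (k - i) = m then 1 else 0) * (a ^ i * b ^ (k - i)) =
        if k = m then ∑ i ∈ range (k + 1), a ^ i * b ^ (k - i) else 0 := by
      rw [sum_congr rfl fun i hi => by
        rw [Nat.add_sub_cancel' (Nat.lt_succ_iff.1 (mem_range.1 hi))]]
      split_ifs <;> simp
    have s4 : ∑ i ∈ range (k + 1), (if i = 0 ∧ k - i = 0 then 1 else 0) * (a ^ i * b ^ (k - i)) =
        if k = 0 then 1 else 0 := by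
      rw [sum_eq_single 0 (fun i _ hi => by simp [hi]) (by simp)]
      by_cases hk : k = 0 <;> simp [hk]
    have s5 : ∑ i ∈ range (k + 1), (if i = m ∧ k - i = 0 then 1 else 0) * (a ^ i * b ^ (k - i)) =
        if k = m then a ^ k else 0 := by
      rw [sum_eq_single k (fun i hi hne => ?_) (by simp)]
      · by_cases hk : k = m <;> simp [hk]
      · have : k - i ≠ 0 := by have := mem_range.1 hi; omega
        simp [this]
    have s6 : ∑ i ∈ range (k + 1), (if i = 0 ∧ k - i = m then 1 else 0) * (a ^ i * b ^ (k - i)) =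
        if k = m then b ^ k else 0 := by
      rw [sum_eq_single 0 (fun i _ hi => by simp [hi]) (by simp)]
      by_cases hk : k = m <;> simp [hk]
    rw [← s5, ← s6, ← s3, ← s4, ← s1, ← s2]
    simp only [mul_sum, ← sum_add_distrib, ← sum_sub_distrib]
    refine sum_congr rfl fun i _ => ?_
    unfold alcoveWeight
    ring
  simp_rw [hin, weightedTriangleSum, triangleSum, sum_add_distrib, sum_sub_distrib, ← mul_sum,
    sum_add_distrib, sum_ite_eq']
  simp

theorem deltaWeight_weightThree {q : ℝ} (h1 : -1 < q) (h2 : q < 1) {m i j : ℕ} (hm : 1 ≤ m)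
    (hij : i + j ≤ m) :
    deltaWeight m q (weightThree i j) =
      alcoveWeight (sideDefect q) (cornerExcess q) m i j := by
  have g0 : Ioi (0 : Fin 3) = {1, 2} := by decide
  have g1 : Ioi (1 : Fin 3) = {2} := by decide
  have g2 : Ioi (2 : Fin 3) = ∅ := by decide
  have n1 : 1 - q ≠ 0 := by linarith
  have n2 : 1 + q ≠ 0 := by linarith
  have n3 : 1 + q + q ^ 2 ≠ 0 := by nlinarith
  have f2 : 1 - q ^ 2 = (1 - q) * (1 + q) := by ring
  have f3 : 1 - q ^ 3 = (1 - q) * (1 + q + q ^ 2) := by ring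
  have hd : deltaWeight m q (weightThree i j) =
      ((if i = 0 then (1 - q) / (1 - q ^ 2) else 1) *
        (if i + j = 0 then (1 - q ^ 2) / (1 - q ^ 3) else 1) *
        (if j = 0 then (1 - q) / (1 - q ^ 2) else 1)) *
      ((if i = m then (1 - q ^ 2) / (1 - q ^ 3) else 1) *
        (if i + j = m then (1 - q) / (1 - q ^ 2) else 1) *
        (if j = m then (1 - q ^ 2) / (1 - q ^ 3) else 1)) := by
    unfold deltaWeight
    simp only [Fin.prod_univ_three, g0, g1, g2, prod_empty, prod_singleton, mul_one]
    rw [prod_insert (by decide), prod_singleton, prod_insert (by decide), prod_singleton]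
    simp only [weightThree_sub_zero_one, weightThree_sub_one_two, weightThree_sub_zero_two,
      Nat.cast_eq_zero, Nat.cast_inj]
    norm_num
  have hm0 : m ≠ 0 := by omega
  rw [hd, f2, f3]
  unfold alcoveWeight sideDefect cornerExcess
  by_cases ci : i = 0 <;> by_cases cj : j = 0
  · subst ci cj
    simp [hm0.symm]
    field_simp
    ring
  · subst ci
    by_cases ck : j = m
    · simp [ck, hm0, hm0.symm]
      field_simp
      ring
    · simp [cj, ck, hm0.symm]
      field_simp
      ring
  · subst cj
    by_cases ck : i = m
    · simp [ck, hm0, hm0.symm]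
      field_simp
      ring
    · simp [ci, ck, hm0.symm]
      field_simp
      ring
  · have di : i ≠ m := by omega
    have dj : j ≠ m := by omega
    by_cases ck : i + j = m
    · simp [ci, cj, ck, di, dj, hm0]
      field_simp
      ring
    · simp [ci, cj, ck, di, dj]

/-- The squared modulus of a Hall-Littlewood polynomial in three variables as a double sum of plane
waves; the common phase of the plane waves drops out. -/
theorem norm_sq_hallLittlewood_three (q : ℝ) (i j : ℕ) (ξ : Fin 3 → ℝ) :
    ((‖hallLittlewood q (weightThree i j) ξ‖ ^ 2 : ℝ) : ℂ) =
      symmSum (fun x y z => symmSum (fun x' y' z' =>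
        waveCoeff (q : ℂ) (phase x) (phase y) (phase z) *
          waveCoeffInv (q : ℂ) (phase x') (phase y') (phase z') *
            ((phase x / phase x') ^ i * (phase x * phase y / (phase x' * phase y')) ^ j))
        (ξ 0) (ξ 1) (ξ 2)) (ξ 0) (ξ 1) (ξ 2) := by
  -- The weight `i ω_1 + j ω_2` is the partition `(i + j, j, 0)` minus the mean of its parts.
  set p := phase (-((i + 2 * j) / 3 * ∑ k, ξ k)) with hp
  set Φ := symmSum (fun x y z => waveCoeff (q : ℂ) (phase x) (phase y) (phase z) *
    (phase x ^ i * (phase x * phase y) ^ j)) (ξ 0) (ξ 1) (ξ 2) with hΦ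
  have hP : hallLittlewood q (weightThree i j) ξ = p * Φ := by
    rw [hΦ, ← sum_perm_fin_three (fun x y z => waveCoeff (q : ℂ) (phase x) (phase y) (phase z) *
      (phase x ^ i * (phase x * phase y) ^ j)) ξ, hallLittlewood, mul_sum]
    refine sum_congr rfl fun σ _ => ?_
    have e : ∑ k, ξ (σ k) * weightThree i j k =
        -((i + 2 * j) / 3 * ∑ k, ξ k) + (i * ξ (σ 0) + j * (ξ (σ 0) + ξ (σ 1))) := by
      rw [← Equiv.sum_comp σ ξ, Fin.sum_univ_three, Fin.sum_univ_three]
      simp [weightThree]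
      ring
    rw [cFun_three, ← phase, e, phase_add, phase_add, phase_nat_mul, phase_nat_mul, phase_add, ← hp]
    ring
  have hΦ' : (starRingEnd ℂ) Φ = symmSum (fun x y z =>
      waveCoeffInv (q : ℂ) (phase x) (phase y) (phase z) *
        ((phase x)⁻¹ ^ i * ((phase x)⁻¹ * (phase y)⁻¹) ^ j)) (ξ 0) (ξ 1) (ξ 2) := by
    simp only [hΦ, symmSum, map_add, map_mul, map_pow, conj_waveCoeff_phase, conj_phase]
  rw [hP, norm_mul, hp, norm_phase, one_mul, Complex.ofReal_pow, ← Complex.mul_conj', hΦ', hΦ,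
    symmSum_mul_symmSum]
  congr 1
  funext x y z
  congr 1
  funext x' y' z'
  rw [div_eq_mul_inv, div_eq_mul_inv, mul_inv, mul_pow, mul_pow, mul_pow, mul_pow, mul_pow, mul_pow]
  ring

/-- The sum over the alcove of the squared Hall-Littlewood polynomials as a sum of pairings. -/
theorem sum_norm_sq_hallLittlewood_three {q : ℝ} (h1 : -1 < q) (h2 : q < 1) {m : ℕ} (hm : 1 ≤ m)
    (ξ : Fin 3 → ℝ) :
    ((∑ μ ∈ (alcove_finite m 3).toFinset, ‖hallLittlewood q μ ξ‖ ^ 2 * deltaWeight m q μ : ℝ) : ℂ) =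
      symmSum (fun x y z => symmSum (wavePairing (q : ℂ) m x y z)
        (phase (ξ 0)) (phase (ξ 1)) (phase (ξ 2))) (phase (ξ 0)) (phase (ξ 1)) (phase (ξ 2)) := by
  rw [sum_alcove_three, Complex.ofReal_sum]
  have hterm (k : ℕ) (hk : k ∈ range (m + 1)) :
      ((∑ i ∈ range (k + 1), ‖hallLittlewood q (weightThree i (k - i)) ξ‖ ^ 2 *
        deltaWeight m q (weightThree i (k - i)) : ℝ) : ℂ) =
      ∑ i ∈ range (k + 1), symmSum (fun x y z => symmSum (fun x' y' z' =>
        waveCoeff (q : ℂ) x y z * waveCoeffInv (q : ℂ) x' y' z' *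
          (alcoveWeight (sideDefect (q : ℂ)) (cornerExcess (q : ℂ)) m i (k - i) *
            ((x / x') ^ i * (x * y / (x' * y')) ^ (k - i))))
        (phase (ξ 0)) (phase (ξ 1)) (phase (ξ 2)))
        (phase (ξ 0)) (phase (ξ 1)) (phase (ξ 2)) := by
    rw [Complex.ofReal_sum]
    refine sum_congr rfl fun i hi => ?_
    have hi' := mem_range.1 hi
    have hk' := mem_range.1 hk
    have hw : ((alcoveWeight (sideDefect q) (cornerExcess q) m i (k - i) : ℝ) : ℂ) =
        alcoveWeight (sideDefect (q : ℂ)) (cornerExcess (q : ℂ)) m i (k - i) := by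
      simp only [alcoveWeight, sideDefect, cornerExcess]
      push_cast [apply_ite Complex.ofReal]
      rfl
    rw [Complex.ofReal_mul, norm_sq_hallLittlewood_three, mul_comm,
      deltaWeight_weightThree h1 h2 hm (by omega), hw]
    simp only [symmSum]
    ring
  rw [sum_congr rfl hterm]
  simp only [sum_symmSum, ← mul_sum, sum_alcoveWeight]
  rfl

theorem betheTriple_phase {q : ℝ} (h1 : -1 < q) (h2 : q < 1) {m : ℕ} {lam ξ : Fin 3 → ℝ}
    (hlam : lam ∈ alcove m 3) (hξ : ∀ k, morseGradient m q lam ξ k = 0) :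
    BetheTriple (q : ℂ) (phase (2 * Real.pi * (rho 3 0 + lam 0))) m
      (phase (ξ 0)) (phase (ξ 1)) (phase (ξ 2)) := by
  have hne {j k : Fin 3} (hjk : j < k) : phase (ξ j) - phase (ξ k) ≠ 0 :=
    have h := sub_mem_Ioo_of_morseGradient_eq_zero h1 h2 hlam hξ hjk
    phase_sub_ne_zero h.1 h.2
  have hq := phase_sub_mul_ne_zero h1 h2
  have hb (k : Fin 3) := bethe_equation h1 h2 (hξ k)
  have b0 := hb 0
  have b1 := hb 1
  have b2 := hb 2
  rw [phase_rho_add_eq hlam (show (0 : Fin 3) < 1 by decide)] at b1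
  rw [phase_rho_add_eq hlam (show (0 : Fin 3) < 2 by decide)] at b2
  rw [Fin.prod_univ_three, div_self (hq _ _)] at b0 b1 b2
  refine ⟨phase_ne_zero _, phase_ne_zero _, phase_ne_zero _, hne (by decide), hne (by decide),
    hne (by decide), hq _ _, hq _ _, hq _ _, hq _ _, hq _ _, hq _ _, ?_, ?_, ?_⟩
  · rw [← b0, scattering, scattering]
    ring
  · rw [← b1, scattering, scattering]
    ring
  · rw [← b2, scattering, scattering]
    ring

theorem det_hessian_three (m : ℕ) {q : ℝ} (h1 : -1 < q) (h2 : q < 1) (lam ξ : Fin 3 → ℝ) :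
    (hessian m q lam ξ).det = m * ((m : ℝ) ^ 2 +
      2 * m * (u q (ξ 0 - ξ 1) + u q (ξ 0 - ξ 2) + u q (ξ 1 - ξ 2)) +
      3 * (u q (ξ 0 - ξ 1) * u q (ξ 0 - ξ 2) + u q (ξ 0 - ξ 1) * u q (ξ 1 - ξ 2) +
        u q (ξ 0 - ξ 2) * u q (ξ 1 - ξ 2))) := by
  have e1 : u q (ξ 1 - ξ 0) = u q (ξ 0 - ξ 1) := by rw [← u_neg, neg_sub]
  have e2 : u q (ξ 2 - ξ 0) = u q (ξ 0 - ξ 2) := by rw [← u_neg, neg_sub]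
  have e3 : u q (ξ 2 - ξ 1) = u q (ξ 1 - ξ 2) := by rw [← u_neg, neg_sub]
  rw [Matrix.det_fin_three]
  simp only [hessian_apply m h1 h2, Fin.sum_univ_three, e1, e2, e3, Pi.single_apply]
  simp
  ring

theorem christoffelCUE_three {m : ℕ} (hm : 1 ≤ m) {q : ℝ} (h1 : -1 < q) (h2 : q < 1)
    {lam : Fin 3 → ℝ} (hlam : lam ∈ alcove m 3) :
    christoffelCUE hm h1 h2 lam =
      (m : ℝ) / 3 * ((hessian m q lam (node hm h1 h2 lam)).det)⁻¹ := by
  set ξ := node hm h1 h2 lam with hξ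
  have hb := betheTriple_phase h1 h2 hlam (morseGradient_node hm h1 h2 lam)
  rw [← hξ] at hb
  have hq : (1 : ℂ) + q ≠ 0 := by
    rw [← Complex.ofReal_one, ← Complex.ofReal_add, Complex.ofReal_ne_zero]
    linarith
  have hq2 : (1 : ℂ) + q + (q : ℂ) ^ 2 ≠ 0 := by
    have : 1 + q + q ^ 2 ≠ 0 := by nlinarith
    exact_mod_cast this
  have hC : ((‖cFun q ξ‖ ^ 2 : ℝ) : ℂ) =
      waveCoeff (q : ℂ) (phase (ξ 0)) (phase (ξ 1)) (phase (ξ 2)) *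
        waveCoeffInv (q : ℂ) (phase (ξ 0)) (phase (ξ 1)) (phase (ξ 2)) := by
    rw [Complex.ofReal_pow, ← Complex.mul_conj', cFun_three, conj_waveCoeff_phase]
  have hC0 : ‖cFun q ξ‖ ^ 2 ≠ 0 := by
    refine pow_ne_zero 2 (norm_ne_zero_iff.2 ?_)
    rw [cFun_three]
    exact mul_ne_zero (mul_ne_zero (div_ne_zero hb.qab hb.ab) (div_ne_zero hb.qac hb.ac))
      (div_ne_zero hb.qbc hb.bc)
  have hS : ∑ μ ∈ (alcove_finite m 3).toFinset, ‖hallLittlewood q μ ξ‖ ^ 2 * deltaWeight m q μ =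
      ‖cFun q ξ‖ ^ 2 * (3 * ((m : ℝ) ^ 2 +
        2 * m * (u q (ξ 0 - ξ 1) + u q (ξ 0 - ξ 2) + u q (ξ 1 - ξ 2)) +
        3 * (u q (ξ 0 - ξ 1) * u q (ξ 0 - ξ 2) + u q (ξ 0 - ξ 1) * u q (ξ 1 - ξ 2) +
          u q (ξ 0 - ξ 2) * u q (ξ 1 - ξ 2)))) := by
    apply Complex.ofReal_injective
    rw [sum_norm_sq_hallLittlewood_three h1 h2 hm, hb.symmSum_symmSum_wavePairing hq hq2,
      Complex.ofReal_mul, hC]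
    push_cast [ofReal_u_sub]
    rfl
  have hm0 : (m : ℝ) ≠ 0 := by positivity
  rw [christoffelCUE, christoffelHat, ← hξ, hS, det_hessian_three m h1 h2, mul_inv, mul_inv,
    mul_inv, mul_inv_cancel_left₀ hC0]
  field_simp

/-! ### The case of two variables -/

section Segment

variable {K : Type*} [Field K]

/-- The sum of `z ^ l` over `0 ≤ l ≤ m`, with the weights of the end points lowered by `s`. -/
def weightedSegmentSum (s : K) (m : ℕ) (z : K) : K :=
  ∑ l ∈ range (m + 1), z ^ l - s * (1 + z ^ m)

/-- The two Bethe equations `S(a, b) ^ 2 * (a / b) ^ m = 1` and its inverse turn the end point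
contributions of the mixed terms into rational functions. -/
theorem scattering_mul_weightedSegmentSum {q a b : K} {m : ℕ} (hb : b ≠ 0) (hab : a - b ≠ 0)
    (hB : a ^ m * scattering q a b = b ^ m * scattering q b a) :
    scattering q a b * weightedSegmentSum (sideDefect q) m (a / b) =
      scattering q a b * (-(b / (a - b)) - sideDefect q) +
        scattering q b a * (-(a / (b - a)) - sideDefect q) := by
  have hne : a / b ≠ 1 := by
    rw [Ne, div_eq_one_iff_eq hb]
    exact sub_ne_zero.1 hab
  have hp : scattering q a b * (a / b) ^ m = scattering q b a := by
    have := pow_ne_zero m hb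
    rw [div_pow, mul_div_assoc', div_eq_iff this]
    linear_combination hB
  have e : a / b - 1 = (a - b) / b := by field_simp
  unfold weightedSegmentSum
  rw [geom_sum_eq hne, e, ← hp, show b - a = -(a - b) by ring, pow_succ]
  generalize (a / b) ^ m = w
  field_simp
  ring

end Segment

theorem cFun_two (q : ℝ) (ξ : Fin 2 → ℝ) :
    cFun q ξ = (phase (ξ 0) - (q : ℂ) * phase (ξ 1)) / (phase (ξ 0) - phase (ξ 1)) := by
  have h0 : Ioi (0 : Fin 2) = {1} := by decide
  have h1 : Ioi (1 : Fin 2) = ∅ := by decide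
  unfold cFun
  simp only [cFun_factor, Fin.prod_univ_two, h0, h1, prod_empty, prod_singleton, mul_one]

theorem conj_coeff_phase (q x y : ℝ) :
    (starRingEnd ℂ) ((phase x - (q : ℂ) * phase y) / (phase x - phase y)) =
      (phase y - (q : ℂ) * phase x) / (phase y - phase x) := by
  have hx := phase_ne_zero x
  have hy := phase_ne_zero y
  simp only [map_mul, map_div₀, map_sub, conj_phase, Complex.conj_ofReal]
  rw [← mul_div_mul_left _ _ (mul_ne_zero hx hy)]
  congr 1 <;> field_simp

/-- The dominant weight `l ω_1` of `SU(2)`. -/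
noncomputable def weightTwo (l : ℕ) : Fin 2 → ℝ := ![(l : ℝ) / 2, -(l : ℝ) / 2]

theorem weightTwo_eq (l : Fin 1 → ℕ) :
    ∑ j, (l j : ℝ) • fundamentalWeight 2 j = weightTwo (l 0) := by
  have h : ∑ j : Fin (2 - 1), (l j : ℝ) • fundamentalWeight 2 j =
    (l 0 : ℝ) • fundamentalWeight 2 0 := Fin.sum_univ_one _
  rw [h]
  ext k
  fin_cases k <;> simp [weightTwo, fundamentalWeight] <;> ring

theorem weightTwo_sub (l : ℕ) : weightTwo l 0 - weightTwo l 1 = l := by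
  simp [weightTwo]
  ring

theorem sum_alcove_two {M : Type*} [AddCommMonoid M] (m : ℕ) (f : (Fin 2 → ℝ) → M) :
    ∑ μ ∈ (alcove_finite m 2).toFinset, f μ = ∑ l ∈ range (m + 1), f (weightTwo l) := by
  symm
  refine sum_nbij weightTwo ?_ ?_ ?_ (fun _ _ => rfl)
  · intro l h
    rw [Set.Finite.mem_toFinset]
    refine ⟨(fun _ => l : Fin 1 → ℕ), ?_, (weightTwo_eq fun _ => l).symm⟩
    have e : ∑ _j : Fin (2 - 1), l = l := Fin.sum_univ_one _
    rw [e]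
    exact Nat.lt_succ_iff.1 (mem_range.1 h)
  · intro l _ l' _ e
    have e0 := weightTwo_sub l
    rw [e, weightTwo_sub, Nat.cast_inj] at e0
    exact e0.symm
  · intro μ h
    rw [Set.Finite.coe_toFinset] at h
    obtain ⟨l, hl, rfl⟩ := h
    have e : ∑ j : Fin (2 - 1), l j = l 0 := Fin.sum_univ_one _
    exact ⟨l 0, by rw [coe_range, Set.mem_Iio]; omega, (weightTwo_eq l).symm⟩

theorem deltaWeight_weightTwo {q : ℝ} (h1 : -1 < q) (h2 : q < 1) {m l : ℕ} (hm : 1 ≤ m) :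
    deltaWeight m q (weightTwo l) =
      1 - sideDefect q * ((if l = 0 then 1 else 0) + if l = m then 1 else 0) := by
  have g0 : Ioi (0 : Fin 2) = {1} := by decide
  have g1 : Ioi (1 : Fin 2) = ∅ := by decide
  have n1 : 1 - q ≠ 0 := by linarith
  have n2 : 1 + q ≠ 0 := by linarith
  have f2 : 1 - q ^ 2 = (1 - q) * (1 + q) := by ring
  have hd : deltaWeight m q (weightTwo l) = (if l = 0 then (1 - q) / (1 - q ^ 2) else 1) *
      (if l = m then (1 - q) / (1 - q ^ 2) else 1) := by
    unfold deltaWeight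
    simp only [Fin.prod_univ_two, g0, g1, prod_empty, prod_singleton, mul_one, weightTwo_sub,
      Nat.cast_eq_zero, Nat.cast_inj]
    norm_num
  have hm0 : m ≠ 0 := by omega
  rw [hd, f2]
  unfold sideDefect
  by_cases c : l = 0
  · subst c
    simp [hm0.symm]
    field_simp
    ring
  · by_cases c' : l = m
    · simp [c', hm0]
      field_simp
      ring
    · simp [c, c']

theorem norm_sq_hallLittlewood_two (q : ℝ) (l : ℕ) (ξ : Fin 2 → ℝ) {a b C C' : ℂ}
    (ha : phase (ξ 0) = a) (hb : phase (ξ 1) = b) (hC : (a - (q : ℂ) * b) / (a - b) = C)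
    (hC' : (b - (q : ℂ) * a) / (b - a) = C') :
    ((‖hallLittlewood q (weightTwo l) ξ‖ ^ 2 : ℝ) : ℂ) =
      2 * (C * C') * 1 ^ l + C ^ 2 * (a / b) ^ l + C' ^ 2 * (b / a) ^ l := by
  have ha0 : a ≠ 0 := ha ▸ phase_ne_zero _
  have hb0 : b ≠ 0 := hb ▸ phase_ne_zero _
  have hP : hallLittlewood q (weightTwo l) ξ =
      phase (-(l / 2 * (ξ 0 + ξ 1))) * (C * a ^ l + C' * b ^ l) := by
    have h : (univ : Finset (Equiv.Perm (Fin 2))) = {1, Equiv.swap 0 1} := by decide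
    rw [hallLittlewood, h, sum_insert (by decide), sum_singleton, ← phase, ← phase, cFun_two,
      cFun_two]
    have e0 : ∑ j, ξ ((1 : Equiv.Perm (Fin 2)) j) * weightTwo l j =
        -(l / 2 * (ξ 0 + ξ 1)) + l * ξ 0 := by
      rw [Fin.sum_univ_two]
      simp [weightTwo]
      ring
    have e1 : ∑ j, ξ (Equiv.swap (0 : Fin 2) 1 j) * weightTwo l j =
        -(l / 2 * (ξ 0 + ξ 1)) + l * ξ 1 := by
      rw [Fin.sum_univ_two]
      simp [weightTwo]
      ring
    rw [e0, e1, phase_add, phase_add, phase_nat_mul, phase_nat_mul]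
    simp only [Equiv.Perm.one_apply, Equiv.swap_apply_left, Equiv.swap_apply_right, ha, hb, hC, hC']
    ring
  -- Complex conjugation inverts `a` and `b` and hence exchanges `C` and `C'`.
  have c1 : (starRingEnd ℂ) C = C' := by
    rw [← hC, ← ha, ← hb, conj_coeff_phase, ha, hb, hC']
  have c2 : (starRingEnd ℂ) C' = C := by rw [← c1, Complex.conj_conj]
  rw [hP, norm_mul, norm_phase, one_mul, Complex.ofReal_pow, ← Complex.mul_conj']
  simp only [map_add, map_mul, map_pow, c1, c2]
  rw [← ha, ← hb, conj_phase, conj_phase, ha, hb, div_pow, div_pow, one_pow, inv_pow, inv_pow]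
  field_simp
  ring

theorem det_hessian_two (m : ℕ) {q : ℝ} (h1 : -1 < q) (h2 : q < 1) (lam ξ : Fin 2 → ℝ) :
    (hessian m q lam ξ).det = m * (m + 2 * u q (ξ 0 - ξ 1)) := by
  have e1 : u q (ξ 1 - ξ 0) = u q (ξ 0 - ξ 1) := by rw [← u_neg, neg_sub]
  rw [Matrix.det_fin_two]
  simp only [hessian_apply m h1 h2, Fin.sum_univ_two, e1, Pi.single_apply]
  simp
  ring

theorem christoffelCUE_two {m : ℕ} (hm : 1 ≤ m) {q : ℝ} (h1 : -1 < q) (h2 : q < 1)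
    {lam : Fin 2 → ℝ} (hlam : lam ∈ alcove m 2) :
    christoffelCUE hm h1 h2 lam =
      (m : ℝ) / 2 * ((hessian m q lam (node hm h1 h2 lam)).det)⁻¹ := by
  set ξ := node hm h1 h2 lam with hξ
  have hgrad (k : Fin 2) : morseGradient m q lam ξ k = 0 := morseGradient_node hm h1 h2 lam k
  have hne : phase (ξ 0) - phase (ξ 1) ≠ 0 :=
    have h := sub_mem_Ioo_of_morseGradient_eq_zero h1 h2 hlam hgrad (show (0 : Fin 2) < 1 by decide)
    phase_sub_ne_zero h.1 h.2
  have hqab := phase_sub_mul_ne_zero h1 h2 (ξ 0) (ξ 1)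
  have hqba := phase_sub_mul_ne_zero h1 h2 (ξ 1) (ξ 0)
  have b0 := bethe_equation h1 h2 (hgrad 0)
  have b1 := bethe_equation h1 h2 (hgrad 1)
  rw [phase_rho_add_eq hlam (show (0 : Fin 2) < 1 by decide), ← b0, Fin.prod_univ_two,
    Fin.prod_univ_two, div_self (phase_sub_mul_ne_zero h1 h2 _ _),
    div_self (phase_sub_mul_ne_zero h1 h2 _ _)] at b1
  have hu := ofReal_u_sub (q := q) (ξ 0) (ξ 1)
  have hC := cFun_two q ξ
  have hCC : ((‖cFun q ξ‖ ^ 2 : ℝ) : ℂ) =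
      (phase (ξ 0) - (q : ℂ) * phase (ξ 1)) / (phase (ξ 0) - phase (ξ 1)) *
        ((phase (ξ 1) - (q : ℂ) * phase (ξ 0)) / (phase (ξ 1) - phase (ξ 0))) := by
    rw [Complex.ofReal_pow, ← Complex.mul_conj', hC, conj_coeff_phase]
  have hP (l : ℕ) := norm_sq_hallLittlewood_two q l ξ rfl rfl rfl rfl
  have ha := phase_ne_zero (ξ 0)
  have hb := phase_ne_zero (ξ 1)
  have hC0 : ‖cFun q ξ‖ ^ 2 ≠ 0 := by
    refine pow_ne_zero 2 (norm_ne_zero_iff.2 ?_)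
    rw [cFun_two]
    exact div_ne_zero hqab hne
  have hq : (1 : ℂ) + q ≠ 0 := by
    rw [← Complex.ofReal_one, ← Complex.ofReal_add, Complex.ofReal_ne_zero]
    linarith
  have hS : ∑ μ ∈ (alcove_finite m 2).toFinset, ‖hallLittlewood q μ ξ‖ ^ 2 * deltaWeight m q μ =
      ‖cFun q ξ‖ ^ 2 * (2 * (m + 2 * u q (ξ 0 - ξ 1))) := by
    apply Complex.ofReal_injective
    rw [Complex.ofReal_mul, hCC, sum_alcove_two, Complex.ofReal_sum]
    push_cast [deltaWeight_weightTwo h1 h2 hm, hu, apply_ite Complex.ofReal] at hP ⊢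
    simp only [hP]
    generalize phase (ξ 0) = a at *
    generalize phase (ξ 1) = b at *
    have hne' : b - a ≠ 0 := sub_ne_zero_symm hne
    set C := (a - (q : ℂ) * b) / (a - b) with hCdef
    set C' := (b - (q : ℂ) * a) / (b - a) with hCdef'
    have hCs : C = scattering (q : ℂ) a b * C' := by
      have hqba' : b - a * (q : ℂ) ≠ 0 := by rwa [mul_comm a]
      rw [hCdef, hCdef', scattering, show b - a = -(a - b) by ring]
      field_simp
    have hCs' : C' = scattering (q : ℂ) b a * C := by
      rw [hCs, ← mul_assoc, scattering_mul_swap hqba hqab, one_mul]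
    have hseg (z : ℂ) : ∑ l ∈ range (m + 1), z ^ l * (1 - (sideDefect q : ℝ) *
        ((if l = 0 then 1 else 0) + if l = m then 1 else 0)) =
        weightedSegmentSum (sideDefect (q : ℂ)) m z := by
      have hcast : ((sideDefect q : ℝ) : ℂ) = sideDefect (q : ℂ) := by simp [sideDefect]
      rw [hcast, weightedSegmentSum]
      simp only [mul_sub, mul_one, mul_add, sum_sub_distrib, sum_add_distrib, mul_ite, mul_zero,
        sum_ite_eq']
      simp
      ring
    have hB : a ^ m * scattering (q : ℂ) a b = b ^ m * scattering (q : ℂ) b a := by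
      rw [scattering, scattering]
      linear_combination b1
    have s1 := scattering_mul_weightedSegmentSum hb hne hB
    have s2 := scattering_mul_weightedSegmentSum ha hne' hB.symm
    have s3 := scattering_pair_sum hne hqab hqba hq
    have s0 : weightedSegmentSum (sideDefect (q : ℂ)) m 1 = m + 1 - 2 * sideDefect (q : ℂ) := by
      simp [weightedSegmentSum]
      ring
    simp only [add_mul, sum_add_distrib, mul_assoc (2 * (C * C')), mul_assoc (C ^ 2),
      mul_assoc (C' ^ 2), ← mul_sum, hseg]
    have p1 : C ^ 2 = C * C' * scattering (q : ℂ) a b := by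
      rw [pow_two, mul_assoc, mul_comm C', ← hCs]
    have p2 : C' ^ 2 = C * C' * scattering (q : ℂ) b a := by
      rw [pow_two, mul_comm C, mul_assoc, mul_comm C (scattering _ _ _), ← hCs']
    rw [p1, p2]
    linear_combination C * C' * (2 * s0 + s1 + s2 + 2 * s3)
  have hm0 : (m : ℝ) ≠ 0 := by positivity
  rw [christoffelCUE, christoffelHat, ← hξ, hS, det_hessian_two m h1 h2, mul_inv, mul_inv, mul_inv,
    mul_inv_cancel_left₀ hC0]
  field_simp

/-! ### The case of one variable -/

theorem christoffelCUE_one {m : ℕ} (hm : 1 ≤ m) {q : ℝ} (h1 : -1 < q) (h2 : q < 1)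
    (lam : Fin 1 → ℝ) :
    christoffelCUE hm h1 h2 lam = m * ((hessian m q lam (node hm h1 h2 lam)).det)⁻¹ := by
  set ξ := node hm h1 h2 lam with hξ
  have hm0 : (m : ℝ) ≠ 0 := by positivity
  have hI : Ioi (0 : Fin 1) = ∅ := by decide
  have hC (η : Fin 1 → ℝ) : cFun q η = 1 := by
    rw [cFun, Fin.prod_univ_one, hI, prod_empty]
  have hA : (alcove_finite m 1).toFinset = {0} := by
    ext μ
    rw [Set.Finite.mem_toFinset, mem_singleton]
    constructor
    · rintro ⟨l, -, rfl⟩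
      exact Fintype.sum_empty (ι := Fin 0) _
    · rintro rfl
      refine ⟨fun _ => 0, by simp, by simp⟩
  have hP : hallLittlewood q 0 ξ = 1 := by
    rw [hallLittlewood, Fintype.sum_unique]
    simp [hC]
  have hD : deltaWeight m q (0 : Fin 1 → ℝ) = 1 := by
    simp [deltaWeight]
  have hH : (hessian m q lam ξ).det = m := by
    rw [Matrix.det_fin_one, hessian_apply m h1 h2]
    simp
  rw [christoffelCUE, christoffelHat, ← hξ, hA, sum_singleton, hP, hD, hC, hH]
  simp [hm0]

end HLCubature

theorem mainTheorem6 (n m : ℕ) (hn : 1 ≤ n) (hn3 : n ≤ 3) (hm : 1 ≤ m)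
    (q : ℝ) (h1 : -1 < q) (h2 : q < 1)
    (lam : Fin n → ℝ) (hlam : lam ∈ HLCubature.alcove m n) :
    HLCubature.christoffelCUE hm h1 h2 lam =
      (m : ℝ) / (n : ℝ) *
        ((HLCubature.hessian m q lam (HLCubature.node hm h1 h2 lam)).det)⁻¹ := by
  interval_cases n
  · rw [HLCubature.christoffelCUE_one hm h1 h2, Nat.cast_one, div_one]
  · exact HLCubature.christoffelCUE_two hm h1 h2 hlam
  · exact HLCubature.christoffelCUE_three hm h1 h2 hlam
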